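/- Let $n,\bar n,m\in\mathbb N$, let $H_0,\dots,H_m$ be Hermitian $n\times n$ matrices, $S_k=-\mathrm i H_k$, and assume that the system $\dot X=(S_0+\sum_{k=1}^m u_k(t)S_k)X$ on $\mathrm U(n)$ is controllable, i.e. any element of $\mathrm U(n)$ can be steered to any other one in finite time by a continuous input $u$. Let $E\in\mathbb C^{n\times\bar n}$ have orthonormal columns, let $K>0$ and $0<c<2$. Put $\mathcal V(\widetilde X)=2\bar n-2\,\Re\operatorname{tr}(E^\dagger\widetilde XE)$ and $\mathrm{pdist}(X,Y)=\|(X-Y)E\|$ (Frobenius norm), and let $\overline{\mathcal B}_c(I)=\{Y\in\mathrm U(n):\mathrm{pdist}(Y,I)\le c\}$. For a reference trajectory $\overline X:[0,T_f]\to\mathrm U(n)$, i.e. a solution of the system for a continuous reference input $\overline u$, put $\widetilde S_k=\overline X^\dagger S_k\overline X$ and consider the feedback $\widetilde u_k=-K\,\nabla_{\widetilde X}\mathcal V\cdot(\widetilde S_k\widetilde X)=2K\,\Re\operatorname{tr}(E^\dagger\widetilde S_k\widetilde XE)$. For $\lambda\in(0,1)$, $\overline X$ is called $\lambda$-attractive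 (in $\overline{\mathcal B}_c(I)$, on $[0,T_f]$) if every solution on $[0,T_f]$ of $\dot{\widetilde X}=(\sum_k\widetilde u_k\widetilde S_k)\widetilde X$ with $\widetilde X(0)\in\overline{\mathcal B}_c(I)$ satisfies $\mathcal V(\widetilde X(T_f))\le\lambda\,\mathcal V(\widetilde X(0))$. RIGA with horizon $T_f$, seed input $\overline u^0$ and a fixed goal matrix $X_{goal}\in\mathrm U(n)$ produces inputs $\overline u^\ell$ and propagators $X^\ell$ on $[0,T_f]$ as follows. $X^0$ is the solution of the system with input $\overline u^0$ and $X^0(0)=I$. For $\ell\ge 0$, let $\overline X^{\ell}(t)=X^{\ell}(t)\,X^{\ell}(T_f)^\dagger X_{goal}$, the reference trajectory with input $\overline u^\ell$ that ends at $X_{goal}$; then $X^{\ell+1}$ is the solution with $X^{\ell+1}(0)=I$ and input $\overline u^{\ell+1}=\overline u^\ell+\widetilde u$, where $\widetilde u$ is the feedback above along $\overline X=\overline X^\ell$ with $\widetilde X=\widetilde X^{\ell+1}:=(\overline X^\ell)^\dagger X^{\ell+1}$. Then there is a function $\theta\mapsto\overline L(\theta)$, depending only on the system (including $E$ and $K$)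 and on $c$, with the following property. Let $F\in\mathbb C^{n\times\bar n}$ and let $X_{goal}\in\mathrm U(n)$ satisfy $X_{goal}E=F$. Let $T>0$, $M\ge1$, and let the seed be $$\overline u^0_k(t)=\sum_{j=1}^M\bigl[a_{kj}\sin(2j\pi t/T)+b_{kj}\cos(2j\pi t/T)\bigr],\qquad k=1,\dots,m,$$ with real coefficients $a_{kj},b_{kj}$; let $L_0>0$ be such that $|\overline u^0_k(t)|\le L_0$ for all $t\ge 0$ and all $k$. Let $\lambda\in(0,1)$ and $T_0\ge0$ be such that for every horizon $T_f>T_0$ the reference trajectory $\overline X^0$ of the seed (which ends at $X_{goal}$ at time $T_f$) is $\lambda$-attractive in $\overline{\mathcal B}_c(I)$ on $[0,T_f]$. Then there is $T^*$ such that for every $T_f>T^*$ for which the initial Lyapunov value satisfies $\mathcal V(\widetilde X^{1}(0))\le c^2$ there is $\theta\in(0,1)$ with: (a) for all $\ell\ge0$ the reference trajectory $\overline X^\ell$ is $\theta$-attractive in $\overline{\mathcal B}_c(I)$ on $[0,T_f]$; (b) the partial distances $d_\ell=\mathrm{pdist}(X^\ell(T_f),X_{goal})$ satisfy $d_{\ell+1}\le\sqrt\theta\,d_\ell$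 for all $\ell\ge0$; in particular $d_\ell\le(\sqrt\theta)^\ell d_0$, and $d_\ell$ is non-increasing and converges to $0$; (c) $|\overline u^\ell_k(t)|\le L_0+\overline L(\theta)$ for all $t\in[0,T_f]$, $k=1,\dots,m$ and $\ell\ge0$. -/

import Mathlib

open Set Filter Topology
open scoped Matrix Matrix.Norms.Frobenius

noncomputable section

namespace RIGA

/-- A closed quantum system `X' = -i (H₀ + ∑ₖ uₖ Hₖ) X` on `U(n)` with `m` real controls. -/
structure QuantumSystem (n m : ℕ) where
  /-- drift Hamiltonian -/
  H₀ : Matrix (Fin n) (Fin n) ℂ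
  /-- control Hamiltonians -/
  H : Fin m → Matrix (Fin n) (Fin n) ℂ
  isHermitian_H₀ : H₀.IsHermitian
  isHermitian_H : ∀ k, (H k).IsHermitian

variable {n m nbar : ℕ}

namespace QuantumSystem

/-- `S₀ = -i H₀`. -/
def S₀ (Q : QuantumSystem n m) : Matrix (Fin n) (Fin n) ℂ := (-Complex.I) • Q.H₀

/-- `Sₖ = -i Hₖ`. -/
def S (Q : QuantumSystem n m) (k : Fin m) : Matrix (Fin n) (Fin n) ℂ := (-Complex.I) • Q.H k

/-- `S₀ + ∑ₖ vₖ Sₖ`. -/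
def gen (Q : QuantumSystem n m) (v : Fin m → ℝ) : Matrix (Fin n) (Fin n) ℂ :=
  Q.S₀ + ∑ k, v k • Q.S k

/-- `X` solves `X' = (S₀ + ∑ₖ uₖ(t) Sₖ) X` on `[0, Tf]`. The open-loop system and the reference
system are both of this form. -/
def IsTrajectory (Q : QuantumSystem n m) (Tf : ℝ) (u : ℝ → Fin m → ℝ)
    (X : ℝ → Matrix (Fin n) (Fin n) ℂ) : Prop :=
  ∀ t ∈ Icc 0 Tf, HasDerivWithinAt X (Q.gen (u t) * X t) (Icc 0 Tf) t

/-- Every point of `U(n)` can be steered to every other one in finite time by a continuous input. -/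
def Controllable (Q : QuantumSystem n m) : Prop :=
  ∀ X₀ ∈ Matrix.unitaryGroup (Fin n) ℂ, ∀ X₁ ∈ Matrix.unitaryGroup (Fin n) ℂ,
    ∃ τ : ℝ, 0 ≤ τ ∧ ∃ u : ℝ → Fin m → ℝ, ContinuousOn u (Icc 0 τ) ∧
      ∃ X : ℝ → Matrix (Fin n) (Fin n) ℂ, Q.IsTrajectory τ u X ∧ X 0 = X₀ ∧ X τ = X₁

end QuantumSystem

/-- The partial trace Lyapunov function `V(X̃) = 2 n̄ - 2 Re tr(E† X̃ E)`. -/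
def lyap (E : Matrix (Fin n) (Fin nbar) ℂ) (Xt : Matrix (Fin n) (Fin n) ℂ) : ℝ :=
  2 * (nbar : ℝ) - 2 * (Matrix.trace (Eᴴ * Xt * E)).re

/-- The partial distance `‖(X - Y) E‖`, in the Frobenius norm. -/
def pdist (E : Matrix (Fin n) (Fin nbar) ℂ) (X Y : Matrix (Fin n) (Fin n) ℂ) : ℝ :=
  ‖(X - Y) * E‖

/-- The closed ball of `U(n)` for the partial distance. -/
def pball (E : Matrix (Fin n) (Fin nbar) ℂ) (c : ℝ) (X : Matrix (Fin n) (Fin n) ℂ) :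
    Set (Matrix (Fin n) (Fin n) ℂ) :=
  {Y | Y ∈ Matrix.unitaryGroup (Fin n) ℂ ∧ pdist E Y X ≤ c}

/-- `S̃ₖ = X̄† Sₖ X̄`. -/
def Stilde (Q : QuantumSystem n m) (Xbar : Matrix (Fin n) (Fin n) ℂ) (k : Fin m) :
    Matrix (Fin n) (Fin n) ℂ :=
  Xbarᴴ * Q.S k * Xbar

/-- The Lyapunov-based feedback `ũₖ = -K (∇V(X̃) · (S̃ₖ X̃))`, where `∇V(X̃) · D` is the
directional derivative of the Lyapunov function at `X̃` in the direction `D`. -/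
def feedback (Q : QuantumSystem n m) (E : Matrix (Fin n) (Fin nbar) ℂ) (K : ℝ)
    (Xbar Xt : Matrix (Fin n) (Fin n) ℂ) (k : Fin m) : ℝ :=
  -K * lineDeriv ℝ (lyap E) Xt (Stilde Q Xbar k * Xt)

/-- The explicit form `ũₖ = 2 K Re tr(E† S̃ₖ X̃ E)` of the feedback. -/
theorem feedback_eq (Q : QuantumSystem n m) (E : Matrix (Fin n) (Fin nbar) ℂ) (K : ℝ)
    (Xbar Xt : Matrix (Fin n) (Fin n) ℂ) (k : Fin m) :
    feedback Q E K Xbar Xt k =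
      2 * K * (Matrix.trace (Eᴴ * Stilde Q Xbar k * Xt * E)).re := by
  have h : HasDerivAt (fun t : ℝ => lyap E (Xt + t • (Stilde Q Xbar k * Xt)))
      (-2 * (Matrix.trace (Eᴴ * Stilde Q Xbar k * Xt * E)).re) 0 := by
    have : (fun t : ℝ => lyap E (Xt + t • (Stilde Q Xbar k * Xt))) = fun t : ℝ =>
        lyap E Xt + t * (-2 * (Matrix.trace (Eᴴ * Stilde Q Xbar k * Xt * E)).re) := by
      funext t
      simp only [lyap, Matrix.mul_add, Matrix.add_mul, Matrix.mul_smul, Matrix.smul_mul, Matrix.trace_add,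
        Matrix.trace_smul, Complex.add_re, Complex.smul_re, smul_eq_mul, Matrix.mul_assoc]
      ring
    rw [this]
    simpa using ((hasDerivAt_id (0 : ℝ)).mul_const
      (-2 * (Matrix.trace (Eᴴ * Stilde Q Xbar k * Xt * E)).re)).const_add (lyap E Xt)
  rw [feedback, lineDeriv, h.deriv]
  ring

/-- `X̃` solves the closed-loop error system `X̃' = (∑ₖ ũₖ S̃ₖ) X̃` on `[0, Tf]` along the reference
trajectory `X̄`. -/
def IsErrorSolution (Q : QuantumSystem n m) (E : Matrix (Fin n) (Fin nbar) ℂ) (K Tf : ℝ)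
    (Xbar Xt : ℝ → Matrix (Fin n) (Fin n) ℂ) : Prop :=
  ∀ t ∈ Icc 0 Tf, HasDerivWithinAt Xt
    ((∑ k, feedback Q E K (Xbar t) (Xt t) k • Stilde Q (Xbar t) k) * Xt t) (Icc 0 Tf) t

/-- The reference trajectory `X̄` on `[0, Tf]` is `lam`-attractive in the ball of radius `c`
centred at the identity. -/
def IsAttractive (Q : QuantumSystem n m) (E : Matrix (Fin n) (Fin nbar) ℂ) (K Tf c lam : ℝ)
    (Xbar : ℝ → Matrix (Fin n) (Fin n) ℂ) : Prop :=
  0 < lam ∧ lam < 1 ∧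
    ∀ X₀ ∈ Matrix.unitaryGroup (Fin n) ℂ, (Xbar 0)ᴴ * X₀ ∈ pball E c 1 →
      ∀ Xt : ℝ → Matrix (Fin n) (Fin n) ℂ, IsErrorSolution Q E K Tf Xbar Xt →
        Xt 0 = (Xbar 0)ᴴ * X₀ → lyap E (Xt Tf) ≤ lam * lyap E (Xt 0)

/-- The seed input `ūₖ(t) = ∑_{j=1}^{M} (a_{kj} sin(2jπt/T) + b_{kj} cos(2jπt/T))`
(the harmonic `j` has index `j - 1` in `Fin M`). -/
def seedInput (T : ℝ) {M : ℕ} (a b : Fin m → Fin M → ℝ) : ℝ → Fin m → ℝ := fun t k =>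
  ∑ j : Fin M, (a k j * Real.sin (2 * ((j : ℝ) + 1) * Real.pi * t / T) +
    b k j * Real.cos (2 * ((j : ℝ) + 1) * Real.pi * t / T))

/-- The right translation `X̄(t) = X(t) R`, `R = X(Tf)† G`, of the trajectory `X`; when `X` is
unitary, it ends at `G`. -/
def refTraj (Tf : ℝ) (G : Matrix (Fin n) (Fin n) ℂ) (X : ℝ → Matrix (Fin n) (Fin n) ℂ) :
    ℝ → Matrix (Fin n) (Fin n) ℂ :=
  fun t => X t * ((X Tf)ᴴ * G)

/-- The inputs `u ℓ = ū^ℓ` and the propagators `X ℓ = X^ℓ` are produced on `[0, Tf]` by the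
algorithm RIGA with the given seed, where `goal ℓ` is the goal matrix of step `ℓ = 1, 2, …`
(`goal 0` is not used). Step `ℓ + 1` uses the reference input `u ℓ` and the reference trajectory
`X̄^ℓ = refTraj Tf (goal (ℓ + 1)) (X ℓ)`. -/
structure IsRun (Q : QuantumSystem n m) (E : Matrix (Fin n) (Fin nbar) ℂ) (K Tf : ℝ)
    (seed : ℝ → Fin m → ℝ) (goal : ℕ → Matrix (Fin n) (Fin n) ℂ)
    (u : ℕ → ℝ → Fin m → ℝ) (X : ℕ → ℝ → Matrix (Fin n) (Fin n) ℂ) : Prop where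
  /-- the seed -/
  seed_eq : ∀ t ∈ Icc 0 Tf, u 0 t = seed t
  /-- every propagator starts at the identity -/
  init : ∀ ℓ, X ℓ 0 = 1
  /-- the open-loop integration with the input `u ℓ` -/
  open_loop : ∀ ℓ, Q.IsTrajectory Tf (u ℓ) (X ℓ)
  /-- the closed-loop integration: `X (ℓ + 1)` is driven by `ū + ũ` -/
  closed_loop : ∀ ℓ, ∀ t ∈ Icc 0 Tf, HasDerivWithinAt (X (ℓ + 1))
    (Q.gen (fun k => u ℓ t k + feedback Q E K (refTraj Tf (goal (ℓ + 1)) (X ℓ) t)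
      ((refTraj Tf (goal (ℓ + 1)) (X ℓ) t)ᴴ * X (ℓ + 1) t) k) * X (ℓ + 1) t) (Icc 0 Tf) t
  /-- the new reference input is `ū + ũ` -/
  update : ∀ ℓ, ∀ t ∈ Icc 0 Tf, ∀ k, u (ℓ + 1) t k = u ℓ t k +
    feedback Q E K (refTraj Tf (goal (ℓ + 1)) (X ℓ) t)
      ((refTraj Tf (goal (ℓ + 1)) (X ℓ) t)ᴴ * X (ℓ + 1) t) k

end RIGA

end

/-! On unitary matrices the Lyapunov value is the squared partial distance to the identity
(`lyap_eq_pdist_sq`). It decreases along every error solution, and the feedback is bounded by a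
constant times that distance (`abs_feedback_le`). If every step contracts the distance by a fixed `r
< 1`, the input corrections are therefore dominated by a geometric series, which gives both the
convergence and the input bound. What has to be shown is that attractivity of the seed passes to all
later references with one common factor.

Write `Tf = j * T + s` with `s` slightly above `T₀`, in a bounded range. Since the seed is periodic,
the seed reference on the last window `[j * T, Tf]` is exactly the one of horizon `s`, hence
attractive. On a window starting at `i * T` it differs from that one by `‖Φ T ^ (j - i) - 1‖`, where
`Φ T` is the propagator over one period (`norm_refTraj_sub_refTraj_shift`). Powers of a unitary
matrix return near `1` (`exists_norm_pow_sub_one_le`), so a long horizon contains many disjoint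
windows on which the seed reference is nearly the attractive one.

Attractivity survives small perturbations of the reference, up to replacing `√lam` by a larger `r <
1` (`pdist_le_of_isAttractive_of_close`). The point is that the perturbation estimate is
proportional to the initial distance. So the first error is already tiny when the last window
begins. All later corrections on that window are then small and summable. As all references end at
the same goal, they stay close to the seed reference there, and so they contract too; this bootstrap
is an induction on the step (`IsRun.contracts`). -/

namespace RIGA

/-! ### Frobenius norm, unitary invariance and traces. -/

section Frobenius

variable {p q r : ℕ}

theorem frobenius_norm_sq (A : Matrix (Fin p) (Fin q) ℂ) : ‖A‖ ^ 2 = (Aᴴ * A).trace.re := by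
  have h : ‖A‖ ^ 2 = ∑ i, ∑ j, ‖A i j‖ ^ 2 := by
    rw [Matrix.frobenius_norm_def, ← Real.sqrt_eq_rpow, Real.sq_sqrt]
    · simp
    · positivity
  rw [h, Matrix.trace, Complex.re_sum, Finset.sum_comm]
  refine Finset.sum_congr rfl fun j _ => ?_
  simp only [Matrix.diag_apply, Matrix.mul_apply, Matrix.conjTranspose_apply, Complex.re_sum]
  refine Finset.sum_congr rfl fun i _ => ?_
  rw [← Complex.normSq_eq_norm_sq, Complex.normSq_apply]
  simp [Complex.mul_re]

theorem norm_unitary_mul {U : Matrix (Fin p) (Fin p) ℂ} (hU : U ∈ Matrix.unitaryGroup (Fin p) ℂ)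
    (A : Matrix (Fin p) (Fin q) ℂ) : ‖U * A‖ = ‖A‖ := by
  have h : Uᴴ * U = 1 := Matrix.mem_unitaryGroup_iff'.1 hU
  refine (sq_eq_sq₀ (norm_nonneg _) (norm_nonneg _)).1 ?_
  rw [frobenius_norm_sq, frobenius_norm_sq, Matrix.conjTranspose_mul, Matrix.mul_assoc,
    ← Matrix.mul_assoc Uᴴ, h, Matrix.one_mul]

theorem conjTranspose_mem_unitaryGroup {U : Matrix (Fin p) (Fin p) ℂ}
    (hU : U ∈ Matrix.unitaryGroup (Fin p) ℂ) : Uᴴ ∈ Matrix.unitaryGroup (Fin p) ℂ :=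
  Unitary.star_mem hU

theorem conjTranspose_mul_self_of_mem {U : Matrix (Fin p) (Fin p) ℂ}
    (hU : U ∈ Matrix.unitaryGroup (Fin p) ℂ) : Uᴴ * U = 1 :=
  Matrix.mem_unitaryGroup_iff'.1 hU

theorem mul_conjTranspose_self_of_mem {U : Matrix (Fin p) (Fin p) ℂ}
    (hU : U ∈ Matrix.unitaryGroup (Fin p) ℂ) : U * Uᴴ = 1 :=
  Matrix.mem_unitaryGroup_iff.1 hU

theorem norm_mul_unitary {U : Matrix (Fin p) (Fin p) ℂ} (hU : U ∈ Matrix.unitaryGroup (Fin p) ℂ)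
    (A : Matrix (Fin q) (Fin p) ℂ) : ‖A * U‖ = ‖A‖ := by
  rw [← Matrix.frobenius_norm_conjTranspose, Matrix.conjTranspose_mul,
    norm_unitary_mul (conjTranspose_mem_unitaryGroup hU), Matrix.frobenius_norm_conjTranspose]

/-- Cauchy–Schwarz for the Frobenius inner product of `A` and the adjoint of `B`. -/
theorem abs_re_trace_mul_le (A : Matrix (Fin p) (Fin q) ℂ) (B : Matrix (Fin q) (Fin p) ℂ) :
    |(A * B).trace.re| ≤ ‖A‖ * ‖B‖ := by
  have hB : ‖B‖ = ‖Bᵀ‖ := (Matrix.frobenius_norm_transpose B).symm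
  have key : ∀ A : Matrix (Fin p) (Fin q) ℂ,
      ‖A‖ = Real.sqrt (∑ x : Fin p × Fin q, ‖A x.1 x.2‖ ^ 2) := fun A => by
    rw [Matrix.frobenius_norm_def, ← Real.sqrt_eq_rpow, Fintype.sum_prod_type]
    simp
  calc |(A * B).trace.re| ≤ ‖(A * B).trace‖ := Complex.abs_re_le_norm _
    _ = ‖∑ x : Fin p × Fin q, A x.1 x.2 * Bᵀ x.1 x.2‖ := by
        rw [Fintype.sum_prod_type]; simp [Matrix.trace, Matrix.mul_apply]
    _ ≤ ∑ x : Fin p × Fin q, ‖A x.1 x.2‖ * ‖Bᵀ x.1 x.2‖ :=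
        (norm_sum_le _ _).trans_eq (by simp)
    _ ≤ ‖A‖ * ‖B‖ := by
        rw [hB, key, key]
        exact Real.sum_mul_le_sqrt_mul_sqrt _ _ _

theorem re_trace_conjTranspose (A : Matrix (Fin p) (Fin p) ℂ) : Aᴴ.trace.re = A.trace.re := by
  rw [Matrix.trace_conjTranspose]; simp

/-- Multiplication by a fixed matrix on the right, as a continuous linear map. -/
noncomputable def mulRightCLM (B : Matrix (Fin q) (Fin r) ℂ) :
    Matrix (Fin p) (Fin q) ℂ →L[ℝ] Matrix (Fin p) (Fin r) ℂ :=
  LinearMap.toContinuousLinearMap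
    { toFun := fun A => A * B
      map_add' := fun A A' => Matrix.add_mul A A' B
      map_smul' := fun x A => Matrix.smul_mul x A B }

theorem hasDerivWithinAt_mul_const {X : ℝ → Matrix (Fin p) (Fin q) ℂ}
    {X' : Matrix (Fin p) (Fin q) ℂ} {s : Set ℝ} {t : ℝ} (h : HasDerivWithinAt X X' s t)
    (B : Matrix (Fin q) (Fin r) ℂ) : HasDerivWithinAt (fun t => X t * B) (X' * B) s t :=
  (mulRightCLM (p := p) B).hasFDerivAt.comp_hasDerivWithinAt t h

/-- The real part of `tr(A† X A)`, as a continuous linear map in `X`. -/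
noncomputable def compressedTraceCLM (A : Matrix (Fin p) (Fin q) ℂ) :
    Matrix (Fin p) (Fin p) ℂ →L[ℝ] ℝ :=
  LinearMap.toContinuousLinearMap
    { toFun := fun X => (Aᴴ * X * A).trace.re
      map_add' := fun X Y => by simp [Matrix.mul_add, Matrix.add_mul]
      map_smul' := fun x X => by simp [Matrix.mul_smul, Matrix.smul_mul, Matrix.trace_smul] }

end Frobenius

/-! ### Linear and quasilinear equations on the unitary group. -/

section ODE

variable {n : ℕ}

theorem hasDerivWithinAt_conjTranspose_mul {X Y : ℝ → Matrix (Fin n) (Fin n) ℂ}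
    {X' Y' : Matrix (Fin n) (Fin n) ℂ} {s : Set ℝ} {t : ℝ} (hX : HasDerivWithinAt X X' s t)
    (hY : HasDerivWithinAt Y Y' s t) :
    HasDerivWithinAt (fun t => (X t)ᴴ * Y t) (X'ᴴ * Y t + (X t)ᴴ * Y') s t :=
  hX.star.mul hY

theorem hasDerivWithinAt_shift {V : Type*} [NormedAddCommGroup V] [NormedSpace ℝ V]
    {X : ℝ → V} {X' : V} {a t Tf s : ℝ}
    (h : HasDerivWithinAt X X' (Icc 0 Tf) (a + t)) (ha : 0 ≤ a) (hs : a + s ≤ Tf) :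
    HasDerivWithinAt (fun t => X (a + t)) X' (Icc 0 s) t := by
  have := h.scomp t (h := fun t => a + t) ((hasDerivWithinAt_id t (Icc 0 s)).const_add a)
    (fun x hx => ⟨by linarith [hx.1], by linarith [hx.2]⟩)
  simpa [Function.comp_def] using this

/-- Two solutions `X, Y` of a linear system with skew-Hermitian generator have constant `X† Y`. -/
theorem conjTranspose_mul_eq_of_skew {A X Y : ℝ → Matrix (Fin n) (Fin n) ℂ} {s : ℝ}
    (hA : ∀ t ∈ Icc 0 s, (A t)ᴴ = -A t)
    (hX : ∀ t ∈ Icc 0 s, HasDerivWithinAt X (A t * X t) (Icc 0 s) t)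
    (hY : ∀ t ∈ Icc 0 s, HasDerivWithinAt Y (A t * Y t) (Icc 0 s) t) :
    ∀ t ∈ Icc 0 s, (X t)ᴴ * Y t = (X 0)ᴴ * Y 0 := by
  intro t ht
  have hd : ∀ x ∈ Icc 0 s, HasDerivWithinAt (fun t => (X t)ᴴ * Y t) 0 (Icc 0 s) x := fun x hx => by
    have := hasDerivWithinAt_conjTranspose_mul (hX x hx) (hY x hx)
    rwa [Matrix.conjTranspose_mul, hA x hx, Matrix.mul_neg, Matrix.neg_mul, Matrix.mul_assoc,
      neg_add_cancel] at this
  have := (convex_Icc 0 s).norm_image_sub_le_of_norm_hasDerivWithin_le (C := 0) hd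
    (fun x _ => by simp) ⟨le_rfl, ht.1.trans ht.2⟩ ht
  rw [zero_mul, norm_le_zero_iff, sub_eq_zero] at this
  exact this

theorem mem_unitaryGroup_of_skew {A X : ℝ → Matrix (Fin n) (Fin n) ℂ} {s : ℝ}
    (hA : ∀ t ∈ Icc 0 s, (A t)ᴴ = -A t)
    (hX : ∀ t ∈ Icc 0 s, HasDerivWithinAt X (A t * X t) (Icc 0 s) t)
    (h0 : X 0 ∈ Matrix.unitaryGroup (Fin n) ℂ) :
    ∀ t ∈ Icc 0 s, X t ∈ Matrix.unitaryGroup (Fin n) ℂ := fun t ht =>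
  Matrix.mem_unitaryGroup_iff'.2 <|
    (conjTranspose_mul_eq_of_skew hA hX hX t ht).trans (conjTranspose_mul_self_of_mem h0)

/-- A Lipschitz cut-off that equals `1` on the ball of radius `R` and vanishes
outside the ball of radius `R + 1`. -/
noncomputable def cutoff {V : Type*} [NormedAddCommGroup V] (R : ℝ) (x : V) : ℝ :=
  max 0 (min 1 (R + 1 - ‖x‖))

section cutoff

variable {V : Type*} [NormedAddCommGroup V] (R : ℝ)

theorem cutoff_nonneg (x : V) : 0 ≤ cutoff R x := le_max_left _ _

theorem cutoff_le_one (x : V) : cutoff R x ≤ 1 := max_le zero_le_one (min_le_left _ _)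

theorem cutoff_eq_one {x : V} (h : ‖x‖ ≤ R) : cutoff R x = 1 := by
  rw [cutoff, min_eq_left (by linarith), max_eq_right zero_le_one]

theorem cutoff_eq_zero {x : V} (h : R + 1 ≤ ‖x‖) : cutoff R x = 0 := by
  rw [cutoff, max_eq_left ((min_le_right _ _).trans (by linarith))]

theorem abs_cutoff_sub_le (x y : V) : |cutoff R x - cutoff R y| ≤ ‖x - y‖ := by
  have h1 : |max 0 (min 1 (R + 1 - ‖x‖)) - max 0 (min 1 (R + 1 - ‖y‖))| ≤
      |(R + 1 - ‖x‖) - (R + 1 - ‖y‖)| := by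
    refine (abs_max_sub_max_le_max _ _ _ _).trans (max_le (by simp) ?_)
    exact (abs_min_sub_min_le_max _ _ _ _).trans (max_le (by simp) le_rfl)
  refine h1.trans ?_
  rw [show (R + 1 - ‖x‖) - (R + 1 - ‖y‖) = ‖y‖ - ‖x‖ by ring, norm_sub_rev]
  exact abs_norm_sub_norm_le y x

/-- Three-term telescoping: vary the cut-off, then the coefficient, then the last factor. The radius
`r` is independent of the cut-off radius `R`. -/
theorem norm_cutoff_smul_mul_sub_le {𝔸 : Type*} [NormedRing 𝔸] [NormedAlgebra ℝ 𝔸] {C r : ℝ}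
    (hC : 0 ≤ C) {x y a b : 𝔸} (ha : ‖a‖ ≤ C) (hb : ‖b‖ ≤ C) (hab : ‖a - b‖ ≤ C * ‖x - y‖)
    (hx : ‖x‖ ≤ r) :
    ‖cutoff R x • a * x - cutoff R y • b * y‖ ≤ (C * r + C * r + C) * ‖x - y‖ := by
  have e : cutoff R x • a * x - cutoff R y • b * y = ((cutoff R x - cutoff R y) • a) * x +
      (cutoff R y • (a - b)) * x + (cutoff R y • b) * (x - y) := by
    simp only [sub_smul, smul_sub, sub_mul, mul_sub]; abel
  have b1 : ‖((cutoff R x - cutoff R y) • a) * x‖ ≤ ‖x - y‖ * C * r := by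
    refine (norm_mul_le _ _).trans ?_
    rw [norm_smul, Real.norm_eq_abs]
    gcongr
    exact abs_cutoff_sub_le R x y
  have b2 : ‖(cutoff R y • (a - b)) * x‖ ≤ 1 * (C * ‖x - y‖) * r := by
    refine (norm_mul_le _ _).trans ?_
    rw [norm_smul, Real.norm_of_nonneg (cutoff_nonneg R y)]
    gcongr
    exact cutoff_le_one R y
  have b3 : ‖(cutoff R y • b) * (x - y)‖ ≤ 1 * C * ‖x - y‖ := by
    refine (norm_mul_le _ _).trans ?_
    rw [norm_smul, Real.norm_of_nonneg (cutoff_nonneg R y)]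
    gcongr
    exact cutoff_le_one R y
  rw [e]
  exact norm_add₃_le.trans ((add_le_add (add_le_add b1 b2) b3).trans_eq (by ring))

end cutoff

/-- Global existence for the equation `X' = A(t, X) X` with a cut-off generator, when `A` is bounded
and Lipschitz in `X` on every ball, uniformly in time. -/
theorem exists_solution_cutoff {𝔸 : Type*} [NormedRing 𝔸] [NormedAlgebra ℝ 𝔸] [CompleteSpace 𝔸]
    {A : ℝ → 𝔸 → 𝔸} {s R : ℝ} (hs : 0 ≤ s) (hR : 0 ≤ R)
    (hcont : ∀ x, ContinuousOn (fun t => A t x) (Icc 0 s))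
    (hlip : ∀ R : ℝ, ∃ C : ℝ, 0 ≤ C ∧ ∀ t ∈ Icc 0 s, ∀ x, ‖x‖ ≤ R → ‖A t x‖ ≤ C ∧
      ∀ y, ‖y‖ ≤ R → ‖A t x - A t y‖ ≤ C * ‖x - y‖) (z : 𝔸) :
    ∃ x : ℝ → 𝔸, x 0 = z ∧
      ∀ t ∈ Icc 0 s, HasDerivWithinAt x (cutoff R (x t) • A t (x t) * x t) (Icc 0 s) t := by
  obtain ⟨C₁, hC₁, h₁⟩ := hlip (R + 1)
  have hbound : ∀ t ∈ Icc 0 s, ∀ x, ‖cutoff R x • A t x * x‖ ≤ C₁ * (R + 1) := fun t ht x => by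
    rcases le_total (R + 1) ‖x‖ with h | h
    · rw [cutoff_eq_zero R h, zero_smul, zero_mul, norm_zero]; positivity
    · calc ‖cutoff R x • A t x * x‖ ≤ ‖cutoff R x • A t x‖ * ‖x‖ := norm_mul_le _ _
        _ = cutoff R x * ‖A t x‖ * ‖x‖ := by
            rw [norm_smul, Real.norm_of_nonneg (cutoff_nonneg R x)]
        _ ≤ 1 * C₁ * (R + 1) := by
            gcongr
            · exact cutoff_le_one R x
            · exact (h₁ t ht x h).1
        _ = C₁ * (R + 1) := by rw [one_mul]
  -- The cut-off field is globally bounded, so this is the farthest a solution can travel in time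
  -- `s`. The Picard ball of this radius around `z` lies in the ball on which `C₂` is taken, and one
  -- application of Picard–Lindelöf covers the whole interval.
  have ha0 : 0 ≤ C₁ * (R + 1) * s := by positivity
  obtain ⟨C₂, hC₂, h₂⟩ := hlip (‖z‖ + C₁ * (R + 1) * s)
  have hpl : IsPicardLindelof (fun t x => cutoff R x • A t x * x) (tmin := 0) (tmax := s)
      ⟨0, le_rfl, hs⟩ z ⟨C₁ * (R + 1) * s, ha0⟩ 0 ⟨C₁ * (R + 1), by positivity⟩
      ⟨C₂ * (‖z‖ + C₁ * (R + 1) * s) + C₂ * (‖z‖ + C₁ * (R + 1) * s) + C₂, by positivity⟩ := by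
    refine ⟨fun t ht => ?_, fun x _ => ?_, fun t ht x _ => hbound t ht x, ?_⟩
    · refine LipschitzOnWith.of_dist_le_mul fun x hx y hy => ?_
      rw [dist_eq_norm, dist_eq_norm]
      have hx' := norm_le_of_mem_closedBall hx
      have hy' := norm_le_of_mem_closedBall hy
      exact norm_cutoff_smul_mul_sub_le R hC₂ (h₂ t ht x hx').1 (h₂ t ht y hy').1
        ((h₂ t ht x hx').2 y hy') hx'
    · exact ((hcont x).const_smul _).mul continuousOn_const
    · change C₁ * (R + 1) * max (s - 0) (0 - 0) ≤ C₁ * (R + 1) * s - 0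
      simp [hs]
  exact hpl.exists_eq_forall_mem_Icc_hasDerivWithinAt₀

/-- Global existence for `X' = A(t, X) X` on the unitary group, for a skew-Hermitian generator
that is bounded and Lipschitz in `X` on every ball, uniformly in time. -/
theorem exists_unitary_solution {A : ℝ → Matrix (Fin n) (Fin n) ℂ → Matrix (Fin n) (Fin n) ℂ}
    {s : ℝ} (hs : 0 ≤ s) (hA : ∀ t ∈ Icc 0 s, ∀ X, (A t X)ᴴ = -A t X)
    (hcont : ∀ X, ContinuousOn (fun t => A t X) (Icc 0 s))
    (hlip : ∀ R : ℝ, ∃ C : ℝ, 0 ≤ C ∧ ∀ t ∈ Icc 0 s, ∀ X, ‖X‖ ≤ R → ‖A t X‖ ≤ C ∧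
      ∀ Y, ‖Y‖ ≤ R → ‖A t X - A t Y‖ ≤ C * ‖X - Y‖)
    {Z : Matrix (Fin n) (Fin n) ℂ} (hZ : Z ∈ Matrix.unitaryGroup (Fin n) ℂ) :
    ∃ X : ℝ → Matrix (Fin n) (Fin n) ℂ, X 0 = Z ∧
      ∀ t ∈ Icc 0 s, HasDerivWithinAt X (A t (X t) * X t) (Icc 0 s) t := by
  -- A real cut-off keeps the generator skew-Hermitian, so the solution stays unitary. All unitary
  -- matrices have the norm of `1`, so with this radius the cut-off is never felt.
  obtain ⟨X, hX0, hX⟩ := exists_solution_cutoff hs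
    (norm_nonneg (1 : Matrix (Fin n) (Fin n) ℂ)) hcont hlip Z
  refine ⟨X, hX0, fun t ht => ?_⟩
  have hu : X t ∈ Matrix.unitaryGroup (Fin n) ℂ := by
    refine mem_unitaryGroup_of_skew (s := s) (fun t ht => ?_) hX (hX0 ▸ hZ) t ht
    rw [Matrix.conjTranspose_smul, hA t ht, smul_neg, star_trivial]
  have hnorm : ‖X t‖ = ‖(1 : Matrix (Fin n) (Fin n) ℂ)‖ := by
    simpa using norm_unitary_mul hu (1 : Matrix (Fin n) (Fin n) ℂ)
  have := hX t ht
  rwa [cutoff_eq_one _ hnorm.le, one_smul] at this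

end ODE

/-! ### Trajectories of the controlled system. -/

variable {n m nbar : ℕ}

namespace QuantumSystem

/-- A common bound for the norms of the control generators. -/
noncomputable def ctrlBound (Q : QuantumSystem n m) : ℝ := ∑ k, ‖Q.S k‖

theorem ctrlBound_nonneg (Q : QuantumSystem n m) : 0 ≤ Q.ctrlBound :=
  Finset.sum_nonneg fun _ _ => norm_nonneg _

theorem norm_S_le (Q : QuantumSystem n m) (k : Fin m) : ‖Q.S k‖ ≤ Q.ctrlBound :=
  Finset.single_le_sum (f := fun k => ‖Q.S k‖) (fun _ _ => norm_nonneg _) (Finset.mem_univ k)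

theorem conjTranspose_S₀ (Q : QuantumSystem n m) : Q.S₀ᴴ = -Q.S₀ := by
  simp [S₀, Matrix.conjTranspose_smul, Q.isHermitian_H₀.eq]

theorem conjTranspose_S (Q : QuantumSystem n m) (k : Fin m) : (Q.S k)ᴴ = -Q.S k := by
  simp [S, Matrix.conjTranspose_smul, (Q.isHermitian_H k).eq]

theorem conjTranspose_gen (Q : QuantumSystem n m) (v : Fin m → ℝ) : (Q.gen v)ᴴ = -Q.gen v := by
  simp only [gen, Matrix.conjTranspose_add, Matrix.conjTranspose_sum, Matrix.conjTranspose_smul,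
    conjTranspose_S₀, conjTranspose_S, star_trivial, smul_neg, Finset.sum_neg_distrib, neg_add]

theorem gen_sub_gen (Q : QuantumSystem n m) (v w : Fin m → ℝ) :
    Q.gen v - Q.gen w = ∑ k, (v k - w k) • Q.S k := by
  simp only [gen, add_sub_add_left_eq_sub, ← Finset.sum_sub_distrib, sub_smul]

theorem IsTrajectory.mem_unitaryGroup {Q : QuantumSystem n m} {Tf : ℝ} {u : ℝ → Fin m → ℝ}
    {X : ℝ → Matrix (Fin n) (Fin n) ℂ} (h : Q.IsTrajectory Tf u X)
    (h0 : X 0 ∈ Matrix.unitaryGroup (Fin n) ℂ) :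
    ∀ t ∈ Icc 0 Tf, X t ∈ Matrix.unitaryGroup (Fin n) ℂ :=
  mem_unitaryGroup_of_skew (fun t _ => Q.conjTranspose_gen (u t)) h h0

theorem IsTrajectory.continuousOn {Q : QuantumSystem n m} {Tf : ℝ} {u : ℝ → Fin m → ℝ}
    {X : ℝ → Matrix (Fin n) (Fin n) ℂ} (h : Q.IsTrajectory Tf u X) : ContinuousOn X (Icc 0 Tf) :=
  fun t ht => (h t ht).continuousWithinAt

theorem IsTrajectory.mul_const {Q : QuantumSystem n m} {Tf : ℝ} {u : ℝ → Fin m → ℝ}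
    {X : ℝ → Matrix (Fin n) (Fin n) ℂ} (h : Q.IsTrajectory Tf u X)
    (B : Matrix (Fin n) (Fin n) ℂ) : Q.IsTrajectory Tf u (fun t => X t * B) := fun t ht => by
  have := hasDerivWithinAt_mul_const (h t ht) B
  rwa [Matrix.mul_assoc] at this

theorem IsTrajectory.shift {Q : QuantumSystem n m} {Tf a s : ℝ} {u : ℝ → Fin m → ℝ}
    {X : ℝ → Matrix (Fin n) (Fin n) ℂ} (h : Q.IsTrajectory Tf u X) (ha : 0 ≤ a)
    (hs : a + s ≤ Tf) : Q.IsTrajectory s (fun t => u (a + t)) (fun t => X (a + t)) :=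
  fun t ht => hasDerivWithinAt_shift
    (h (a + t) ⟨by linarith [ht.1], by linarith [ht.2]⟩) ha hs

theorem IsTrajectory.congr {Q : QuantumSystem n m} {Tf : ℝ} {u v : ℝ → Fin m → ℝ}
    {X : ℝ → Matrix (Fin n) (Fin n) ℂ} (h : Q.IsTrajectory Tf u X)
    (huv : ∀ t ∈ Icc 0 Tf, u t = v t) : Q.IsTrajectory Tf v X :=
  fun t ht => huv t ht ▸ h t ht

theorem IsTrajectory.mono {Q : QuantumSystem n m} {Tf s : ℝ} {u : ℝ → Fin m → ℝ}
    {X : ℝ → Matrix (Fin n) (Fin n) ℂ} (h : Q.IsTrajectory Tf u X) (hs : s ≤ Tf) :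
    Q.IsTrajectory s u X :=
  fun t ht => (h t ⟨ht.1, ht.2.trans hs⟩).mono (Icc_subset_Icc_right hs)

/-- Trajectories with the same input differ by a right translation. -/
theorem IsTrajectory.eq_mul {Q : QuantumSystem n m} {Tf : ℝ} {u : ℝ → Fin m → ℝ}
    {X Y : ℝ → Matrix (Fin n) (Fin n) ℂ} (hX : Q.IsTrajectory Tf u X)
    (hY : Q.IsTrajectory Tf u Y) (h0 : X 0 = 1) : ∀ t ∈ Icc 0 Tf, Y t = X t * Y 0 := by
  intro t ht
  have h := conjTranspose_mul_eq_of_skew (fun t _ => Q.conjTranspose_gen (u t)) hX hY t ht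
  have hu := mul_conjTranspose_self_of_mem
    (hX.mem_unitaryGroup (h0 ▸ one_mem _) t ht)
  rw [h0, Matrix.conjTranspose_one, Matrix.one_mul] at h
  rw [← h, ← Matrix.mul_assoc, hu, Matrix.one_mul]

theorem exists_isTrajectory (Q : QuantumSystem n m) {Tf : ℝ} (hT : 0 ≤ Tf) {u : ℝ → Fin m → ℝ}
    (hu : ContinuousOn u (Icc 0 Tf)) :
    ∃ X : ℝ → Matrix (Fin n) (Fin n) ℂ, X 0 = 1 ∧ Q.IsTrajectory Tf u X := by
  have hc : ContinuousOn (fun t => Q.gen (u t)) (Icc 0 Tf) := by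
    refine continuousOn_const.add (continuousOn_finsetSum _ fun k _ => ?_)
    exact (((continuous_apply k).comp_continuousOn hu).smul continuousOn_const)
  obtain ⟨C, hC⟩ := isCompact_Icc.exists_bound_of_continuousOn hc
  refine exists_unitary_solution (A := fun t _ => Q.gen (u t)) hT
    (fun t _ _ => Q.conjTranspose_gen (u t)) (fun _ => hc) (fun R => ?_) (one_mem _)
  refine ⟨|C|, abs_nonneg _, fun t ht X _ => ⟨(hC t ht).trans (le_abs_self _), fun Y _ => ?_⟩⟩
  rw [sub_self, norm_zero]; positivity

end QuantumSystem

/-! ### Size and Lipschitz dependence of the feedback. -/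

variable {Q : QuantumSystem n m} {E : Matrix (Fin n) (Fin nbar) ℂ} {K : ℝ}

theorem conjTranspose_Stilde (Q : QuantumSystem n m) (Xbar : Matrix (Fin n) (Fin n) ℂ)
    (k : Fin m) : (Stilde Q Xbar k)ᴴ = -Stilde Q Xbar k := by
  simp [Stilde, Matrix.conjTranspose_mul, Q.conjTranspose_S, Matrix.mul_assoc]

theorem norm_Stilde_le {Xbar : Matrix (Fin n) (Fin n) ℂ}
    (h : Xbar ∈ Matrix.unitaryGroup (Fin n) ℂ) (k : Fin m) :
    ‖Stilde Q Xbar k‖ ≤ Q.ctrlBound := by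
  rw [Stilde, norm_mul_unitary h, norm_unitary_mul (conjTranspose_mem_unitaryGroup h)]
  exact Q.norm_S_le k

theorem norm_Stilde_sub_le {X Y : Matrix (Fin n) (Fin n) ℂ}
    (hX : X ∈ Matrix.unitaryGroup (Fin n) ℂ) (hY : Y ∈ Matrix.unitaryGroup (Fin n) ℂ)
    (k : Fin m) : ‖Stilde Q X k - Stilde Q Y k‖ ≤ 2 * Q.ctrlBound * ‖X - Y‖ := by
  have e : Stilde Q X k - Stilde Q Y k = Xᴴ * (Q.S k * (X - Y)) + (X - Y)ᴴ * Q.S k * Y := by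
    simp only [Stilde, Matrix.mul_sub, Matrix.sub_mul, Matrix.conjTranspose_sub, Matrix.mul_assoc]
    abel
  have h1 : ‖Xᴴ * (Q.S k * (X - Y))‖ ≤ Q.ctrlBound * ‖X - Y‖ := by
    rw [norm_unitary_mul (conjTranspose_mem_unitaryGroup hX)]
    exact (norm_mul_le _ _).trans (by gcongr; exact Q.norm_S_le k)
  have h2 : ‖(X - Y)ᴴ * Q.S k * Y‖ ≤ ‖X - Y‖ * Q.ctrlBound := by
    rw [norm_mul_unitary hY]
    refine (norm_mul_le _ _).trans ?_
    rw [Matrix.frobenius_norm_conjTranspose]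
    gcongr; exact Q.norm_S_le k
  rw [e]
  linarith [norm_add_le (Xᴴ * (Q.S k * (X - Y))) ((X - Y)ᴴ * Q.S k * Y)]

theorem pdist_nonneg (E : Matrix (Fin n) (Fin nbar) ℂ) (X Y : Matrix (Fin n) (Fin n) ℂ) :
    0 ≤ pdist E X Y := norm_nonneg _

theorem pdist_mul_left {U : Matrix (Fin n) (Fin n) ℂ} (hU : U ∈ Matrix.unitaryGroup (Fin n) ℂ)
    (E : Matrix (Fin n) (Fin nbar) ℂ) (X Y : Matrix (Fin n) (Fin n) ℂ) :
    pdist E (U * X) (U * Y) = pdist E X Y := by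
  rw [pdist, ← Matrix.mul_sub, Matrix.mul_assoc, norm_unitary_mul hU, pdist]

/-- Expand the square, using that `X` is unitary and that `E` has orthonormal columns. A factor `θ`
for `lyap` thus corresponds to `√θ` for `pdist`. -/
theorem lyap_eq_pdist_sq (hE : Eᴴ * E = 1) {X : Matrix (Fin n) (Fin n) ℂ}
    (hX : X ∈ Matrix.unitaryGroup (Fin n) ℂ) : lyap E X = pdist E X 1 ^ 2 := by
  have hXX := conjTranspose_mul_self_of_mem hX
  have e : ((X - 1) * E)ᴴ * ((X - 1) * E) =
      (1 + 1 : Matrix (Fin nbar) (Fin nbar) ℂ) - Eᴴ * X * E - (Eᴴ * X * E)ᴴ := by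
    have h1 : (X - 1)ᴴ * (X - 1) = 1 + 1 - X - Xᴴ := by
      rw [Matrix.conjTranspose_sub, Matrix.conjTranspose_one, Matrix.sub_mul, Matrix.mul_sub,
        Matrix.mul_sub, hXX]
      simp only [Matrix.one_mul, Matrix.mul_one]
      abel
    rw [Matrix.conjTranspose_mul, Matrix.mul_assoc, ← Matrix.mul_assoc _ _ E, h1]
    simp only [Matrix.sub_mul, Matrix.add_mul, Matrix.mul_sub, Matrix.mul_add, Matrix.one_mul,
      hE, Matrix.conjTranspose_mul, Matrix.conjTranspose_conjTranspose, Matrix.mul_assoc]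
  rw [pdist, frobenius_norm_sq, e, Matrix.trace_sub, Matrix.trace_sub, Matrix.trace_add,
    Matrix.trace_one, Complex.sub_re, Complex.sub_re, re_trace_conjTranspose, lyap]
  simp
  ring

/-- The matrix `Eᴴ * Stilde Q Xbar k * E` is skew-Hermitian, so its trace is imaginary and
subtracting the identity costs nothing. This makes the feedback small where the partial distance is
small. -/
theorem feedback_eq_sub_one (Q : QuantumSystem n m) (E : Matrix (Fin n) (Fin nbar) ℂ) (K : ℝ)
    (Xbar Xt : Matrix (Fin n) (Fin n) ℂ) (k : Fin m) :
    feedback Q E K Xbar Xt k =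
      2 * K * ((Eᴴ * Stilde Q Xbar k) * ((Xt - 1) * E)).trace.re := by
  have h0 : (Eᴴ * Stilde Q Xbar k * E).trace.re = 0 := by
    have := re_trace_conjTranspose (Eᴴ * Stilde Q Xbar k * E)
    rw [Matrix.conjTranspose_mul, Matrix.conjTranspose_mul, conjTranspose_Stilde,
      Matrix.conjTranspose_conjTranspose, Matrix.neg_mul, Matrix.mul_neg, Matrix.trace_neg,
      Complex.neg_re, ← Matrix.mul_assoc] at this
    linarith
  rw [feedback_eq, Matrix.sub_mul, Matrix.one_mul, Matrix.mul_sub, Matrix.trace_sub,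
    Complex.sub_re, h0, sub_zero, Matrix.mul_assoc _ Xt]

theorem abs_feedback_le (hK : 0 ≤ K) {Xbar : Matrix (Fin n) (Fin n) ℂ}
    (h : Xbar ∈ Matrix.unitaryGroup (Fin n) ℂ) (Xt : Matrix (Fin n) (Fin n) ℂ) (k : Fin m) :
    |feedback Q E K Xbar Xt k| ≤ 2 * K * ‖E‖ * Q.ctrlBound * pdist E Xt 1 := by
  rw [feedback_eq_sub_one, abs_mul, abs_of_nonneg (by positivity : 0 ≤ 2 * K)]
  have h1 := abs_re_trace_mul_le (Eᴴ * Stilde Q Xbar k) ((Xt - 1) * E)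
  have h2 : ‖Eᴴ * Stilde Q Xbar k‖ ≤ ‖E‖ * Q.ctrlBound := by
    refine (Matrix.frobenius_norm_mul _ _).trans ?_
    rw [Matrix.frobenius_norm_conjTranspose]
    gcongr
    exact norm_Stilde_le h k
  calc 2 * K * |((Eᴴ * Stilde Q Xbar k) * ((Xt - 1) * E)).trace.re|
      ≤ 2 * K * (‖E‖ * Q.ctrlBound * ‖(Xt - 1) * E‖) := by
        gcongr
        exact h1.trans (by gcongr)
    _ = _ := by rw [pdist]; ring

theorem abs_feedback_sub_le (hK : 0 ≤ K) {X Y : Matrix (Fin n) (Fin n) ℂ}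
    (hX : X ∈ Matrix.unitaryGroup (Fin n) ℂ) (hY : Y ∈ Matrix.unitaryGroup (Fin n) ℂ)
    (Xt Yt : Matrix (Fin n) (Fin n) ℂ) (k : Fin m) :
    |feedback Q E K X Xt k - feedback Q E K Y Yt k| ≤
      2 * K * ‖E‖ * Q.ctrlBound * (2 * ‖X - Y‖ * pdist E Xt 1 + ‖(Xt - Yt) * E‖) := by
  have e : feedback Q E K X Xt k - feedback Q E K Y Yt k =
      2 * K * (((Eᴴ * (Stilde Q X k - Stilde Q Y k)) * ((Xt - 1) * E)).trace.re +
        ((Eᴴ * Stilde Q Y k) * ((Xt - Yt) * E)).trace.re) := by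
    rw [feedback_eq_sub_one, feedback_eq_sub_one, ← mul_sub, ← Complex.sub_re, ← Complex.add_re,
      ← Matrix.trace_sub, ← Matrix.trace_add]
    congr 4
    simp only [Matrix.mul_sub, Matrix.sub_mul]
    abel
  have h1 := abs_re_trace_mul_le (Eᴴ * (Stilde Q X k - Stilde Q Y k)) ((Xt - 1) * E)
  have h2 := abs_re_trace_mul_le (Eᴴ * Stilde Q Y k) ((Xt - Yt) * E)
  have h3 : ‖Eᴴ * (Stilde Q X k - Stilde Q Y k)‖ ≤ ‖E‖ * (2 * Q.ctrlBound * ‖X - Y‖) := by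
    refine (Matrix.frobenius_norm_mul _ _).trans ?_
    rw [Matrix.frobenius_norm_conjTranspose]
    gcongr
    exact norm_Stilde_sub_le hX hY k
  have h4 : ‖Eᴴ * Stilde Q Y k‖ ≤ ‖E‖ * Q.ctrlBound := by
    refine (Matrix.frobenius_norm_mul _ _).trans ?_
    rw [Matrix.frobenius_norm_conjTranspose]
    gcongr
    exact norm_Stilde_le hY k
  rw [e, abs_mul, abs_of_nonneg (by positivity : 0 ≤ 2 * K)]
  calc 2 * K * |((Eᴴ * (Stilde Q X k - Stilde Q Y k)) * ((Xt - 1) * E)).trace.re +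
        ((Eᴴ * Stilde Q Y k) * ((Xt - Yt) * E)).trace.re|
      ≤ 2 * K * (‖E‖ * (2 * Q.ctrlBound * ‖X - Y‖) * ‖(Xt - 1) * E‖ +
          ‖E‖ * Q.ctrlBound * ‖(Xt - Yt) * E‖) := by
        gcongr
        refine (abs_add_le _ _).trans (add_le_add (h1.trans ?_) (h2.trans ?_)) <;> gcongr
    _ = _ := by rw [pdist]; ring

/-- The generator `∑ₖ ũₖ S̃ₖ` of the closed-loop error system. -/
noncomputable def errorGen (Q : QuantumSystem n m) (E : Matrix (Fin n) (Fin nbar) ℂ) (K : ℝ)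
    (Xbar Xt : Matrix (Fin n) (Fin n) ℂ) : Matrix (Fin n) (Fin n) ℂ :=
  ∑ k, feedback Q E K Xbar Xt k • Stilde Q Xbar k

theorem conjTranspose_errorGen (Xbar Xt : Matrix (Fin n) (Fin n) ℂ) :
    (errorGen Q E K Xbar Xt)ᴴ = -errorGen Q E K Xbar Xt := by
  simp only [errorGen, Matrix.conjTranspose_sum, Matrix.conjTranspose_smul, conjTranspose_Stilde,
    star_trivial, smul_neg, Finset.sum_neg_distrib]

/-! ### The closed-loop error system: decay and existence. -/

section ErrorSolution

variable {Tf : ℝ} {Xbar Xt : ℝ → Matrix (Fin n) (Fin n) ℂ}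

theorem IsErrorSolution.mem_unitaryGroup (h : IsErrorSolution Q E K Tf Xbar Xt)
    (h0 : Xt 0 ∈ Matrix.unitaryGroup (Fin n) ℂ) :
    ∀ t ∈ Icc 0 Tf, Xt t ∈ Matrix.unitaryGroup (Fin n) ℂ :=
  mem_unitaryGroup_of_skew (fun t _ => conjTranspose_errorGen (Xbar t) (Xt t)) h h0

theorem IsErrorSolution.shift (h : IsErrorSolution Q E K Tf Xbar Xt) {a s : ℝ} (ha : 0 ≤ a)
    (hs : a + s ≤ Tf) :
    IsErrorSolution Q E K s (fun t => Xbar (a + t)) (fun t => Xt (a + t)) :=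
  fun t ht => hasDerivWithinAt_shift
    (h (a + t) ⟨by linarith [ht.1], by linarith [ht.2]⟩) ha hs

/-- The feedback descends the gradient along each control direction: the derivative of `lyap` is
`-K⁻¹` times the sum of the squared feedbacks. -/
theorem IsErrorSolution.antitoneOn_lyap (hK : 0 < K) (h : IsErrorSolution Q E K Tf Xbar Xt) :
    AntitoneOn (fun t => lyap E (Xt t)) (Icc 0 Tf) := by
  have hd : ∀ t ∈ Icc 0 Tf, HasDerivWithinAt (fun t => lyap E (Xt t))
      (-(K⁻¹ * ∑ k, feedback Q E K (Xbar t) (Xt t) k ^ 2)) (Icc 0 Tf) t := fun t ht => by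
    have h1 := ((compressedTraceCLM E).hasFDerivAt.comp_hasDerivWithinAt t (h t ht))
    have h2 := (h1.const_mul 2).const_sub (2 * (nbar : ℝ))
    refine h2.congr_deriv ?_
    change -(2 * (Eᴴ * ((∑ k, feedback Q E K (Xbar t) (Xt t) k • Stilde Q (Xbar t) k) * Xt t) *
      E).trace.re) = _
    rw [Matrix.sum_mul, Matrix.mul_sum, Matrix.sum_mul, Matrix.trace_sum, Complex.re_sum,
      Finset.mul_sum, Finset.mul_sum]
    congr 1
    refine Finset.sum_congr rfl fun k _ => ?_
    rw [Matrix.smul_mul, Matrix.mul_smul, Matrix.smul_mul, Matrix.trace_smul, Complex.smul_re,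
      smul_eq_mul, ← Matrix.mul_assoc Eᴴ]
    have := feedback_eq Q E K (Xbar t) (Xt t) k
    rw [show (Eᴴ * Stilde Q (Xbar t) k * Xt t * E).trace.re =
        (2 * K)⁻¹ * feedback Q E K (Xbar t) (Xt t) k by
      rw [this, ← mul_assoc, inv_mul_cancel₀ (by positivity), one_mul]]
    field_simp
  refine antitoneOn_of_hasDerivWithinAt_nonpos (convex_Icc 0 Tf)
    (fun t ht => (hd t ht).continuousWithinAt)
    (fun t ht => (hd t (interior_subset ht)).mono interior_subset) fun t _ => ?_
  have : 0 ≤ K⁻¹ * ∑ k, feedback Q E K (Xbar t) (Xt t) k ^ 2 := by positivity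
  linarith

theorem IsErrorSolution.pdist_antitoneOn (hE : Eᴴ * E = 1) (hK : 0 < K)
    (h : IsErrorSolution Q E K Tf Xbar Xt) (h0 : Xt 0 ∈ Matrix.unitaryGroup (Fin n) ℂ) :
    AntitoneOn (fun t => pdist E (Xt t) 1) (Icc 0 Tf) := fun s hs t ht hst => by
  have := h.antitoneOn_lyap hK hs ht hst
  simp only [lyap_eq_pdist_sq hE (h.mem_unitaryGroup h0 _ hs),
    lyap_eq_pdist_sq hE (h.mem_unitaryGroup h0 _ ht)] at this
  exact (sq_le_sq₀ (pdist_nonneg _ _ _) (pdist_nonneg _ _ _)).1 this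

theorem norm_feedback_smul_Stilde_le (hK : 0 ≤ K) {W : Matrix (Fin n) (Fin n) ℂ}
    (hW : W ∈ Matrix.unitaryGroup (Fin n) ℂ) (X Y : Matrix (Fin n) (Fin n) ℂ) (k : Fin m) :
    ‖(feedback Q E K W X k - feedback Q E K W Y k) • Stilde Q W k‖ ≤
      2 * K * ‖E‖ ^ 2 * Q.ctrlBound ^ 2 * ‖X - Y‖ := by
  have h1 := abs_feedback_sub_le (Q := Q) (E := E) hK hW hW X Y k
  rw [sub_self, norm_zero, mul_zero, zero_mul, zero_add] at h1
  have h2 := Q.ctrlBound_nonneg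
  rw [norm_smul, Real.norm_eq_abs]
  calc _ ≤ 2 * K * ‖E‖ * Q.ctrlBound * (‖X - Y‖ * ‖E‖) * Q.ctrlBound := by
        gcongr
        · exact h1.trans (by gcongr; exact Matrix.frobenius_norm_mul _ _)
        · exact norm_Stilde_le hW k
    _ = _ := by ring

theorem norm_errorGen_sub_le (hK : 0 ≤ K) {W : Matrix (Fin n) (Fin n) ℂ}
    (hW : W ∈ Matrix.unitaryGroup (Fin n) ℂ) (X Y : Matrix (Fin n) (Fin n) ℂ) :
    ‖errorGen Q E K W X - errorGen Q E K W Y‖ ≤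
      m * (2 * K * ‖E‖ ^ 2 * Q.ctrlBound ^ 2) * ‖X - Y‖ := by
  simp only [errorGen, ← Finset.sum_sub_distrib, ← sub_smul]
  refine (norm_sum_le_of_le _ fun k _ => norm_feedback_smul_Stilde_le hK hW X Y k).trans_eq ?_
  simp
  ring

theorem errorGen_zero (W : Matrix (Fin n) (Fin n) ℂ) : errorGen Q E K W 0 = 0 := by
  simp [errorGen, feedback_eq]

/-- The closed-loop error system has a solution for every unitary initial value. -/
theorem exists_isErrorSolution (hK : 0 ≤ K) (hT : 0 ≤ Tf) (hc : ContinuousOn Xbar (Icc 0 Tf))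
    (hu : ∀ t ∈ Icc 0 Tf, Xbar t ∈ Matrix.unitaryGroup (Fin n) ℂ)
    {Z : Matrix (Fin n) (Fin n) ℂ} (hZ : Z ∈ Matrix.unitaryGroup (Fin n) ℂ) :
    ∃ Xt, Xt 0 = Z ∧ IsErrorSolution Q E K Tf Xbar Xt := by
  refine exists_unitary_solution (A := fun t X => errorGen Q E K (Xbar t) X) hT
    (fun t _ X => conjTranspose_errorGen (Xbar t) X) (fun X => ?_) (fun R => ?_) hZ
  · have hS : ∀ k, ContinuousOn (fun t => Stilde Q (Xbar t) k) (Icc 0 Tf) := fun k =>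
      (hc.star.mul continuousOn_const).mul hc
    refine continuousOn_finsetSum _ fun k _ => ContinuousOn.fun_smul ?_ (hS k)
    have : (fun t => feedback Q E K (Xbar t) X k) =
        fun t => 2 * K * compressedTraceCLM E (Stilde Q (Xbar t) k * X) := by
      funext t
      rw [feedback_eq, Matrix.mul_assoc Eᴴ]
      rfl
    rw [this]
    exact continuousOn_const.mul
      ((compressedTraceCLM E).continuous.comp_continuousOn ((hS k).mul continuousOn_const))
  · refine ⟨m * (2 * K * ‖E‖ ^ 2 * Q.ctrlBound ^ 2) * (|R| + 1), by positivity,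
      fun t ht X hX => ⟨?_, fun Y _ => ?_⟩⟩
    · have := norm_errorGen_sub_le (Q := Q) (E := E) hK (hu t ht) X 0
      rw [errorGen_zero, sub_zero, sub_zero] at this
      refine this.trans ?_
      gcongr
      linarith [le_abs_self R]
    · refine (norm_errorGen_sub_le hK (hu t ht) X Y).trans ?_
      exact mul_le_mul_of_nonneg_right
        (le_mul_of_one_le_right (by positivity) (by linarith [abs_nonneg R])) (norm_nonneg _)

end ErrorSolution

/-! ### Dependence of the error system on the reference trajectory. -/

section Perturbation

variable {Xbar Xt Ybar Yt : ℝ → Matrix (Fin n) (Fin n) ℂ}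

/-- The exponential rate of the dependence of the error system on the reference trajectory. -/
noncomputable def errorRate (Q : QuantumSystem n m) (E : Matrix (Fin n) (Fin nbar) ℂ) (K : ℝ) : ℝ :=
  m * (8 * K * ‖E‖ ^ 2 * Q.ctrlBound ^ 2) + 1

theorem errorRate_pos (hK : 0 ≤ K) : 0 < errorRate Q E K := by
  unfold errorRate; positivity

/-- The inhomogeneous term is `δ * ρ` and not just `δ`: changing the reference acts only through
feedbacks that are themselves of order `ρ`. This is what makes the later comparison relative to the
initial distance. -/
theorem norm_errorGen_mul_sub_le (hK : 0 ≤ K) {V W X Y : Matrix (Fin n) (Fin n) ℂ} {δ ρ : ℝ}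
    (hV : V ∈ Matrix.unitaryGroup (Fin n) ℂ) (hW : W ∈ Matrix.unitaryGroup (Fin n) ℂ)
    (hX : X ∈ Matrix.unitaryGroup (Fin n) ℂ) (hY : Y ∈ Matrix.unitaryGroup (Fin n) ℂ)
    (hVW : ‖V - W‖ ≤ δ) (hXρ : pdist E X 1 ≤ ρ) (hYρ : pdist E Y 1 ≤ ρ) :
    ‖errorGen Q E K V X * X * E - errorGen Q E K W Y * Y * E‖ ≤
      errorRate Q E K * ‖(X - Y) * E‖ + errorRate Q E K * (δ * ρ) := by
  have hσ := Q.ctrlBound_nonneg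
  have hδ : 0 ≤ δ := (norm_nonneg _).trans hVW
  have hρ : 0 ≤ ρ := (pdist_nonneg _ _ _).trans hXρ
  have hYE : pdist E Y 1 ≤ 2 * ‖E‖ := by
    rw [pdist, Matrix.sub_mul, Matrix.one_mul]
    refine (norm_sub_le _ _).trans ?_
    rw [norm_unitary_mul hY]; linarith
  have e : errorGen Q E K V X * X * E - errorGen Q E K W Y * Y * E =
      ∑ k, ((feedback Q E K V X k - feedback Q E K W Y k) • (Stilde Q V k * (X * E)) +
        feedback Q E K W Y k • ((Stilde Q V k - Stilde Q W k) * (X * E)) +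
        feedback Q E K W Y k • (Stilde Q W k * ((X - Y) * E))) := by
    simp only [errorGen, Finset.sum_mul, Matrix.smul_mul]
    simp only [Matrix.sum_mul, Matrix.smul_mul, ← Finset.sum_sub_distrib,
      Matrix.mul_assoc]
    refine Finset.sum_congr rfl fun k _ => ?_
    simp only [sub_smul, smul_sub, Matrix.sub_mul, Matrix.mul_sub]
    abel
  have b : ∀ k, ‖(feedback Q E K V X k - feedback Q E K W Y k) • (Stilde Q V k * (X * E)) +
        feedback Q E K W Y k • ((Stilde Q V k - Stilde Q W k) * (X * E)) +
        feedback Q E K W Y k • (Stilde Q W k * ((X - Y) * E))‖ ≤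
      8 * K * ‖E‖ ^ 2 * Q.ctrlBound ^ 2 * (‖(X - Y) * E‖ + δ * ρ) := fun k => by
    have b1 : ‖(feedback Q E K V X k - feedback Q E K W Y k) • (Stilde Q V k * (X * E))‖ ≤
        2 * K * ‖E‖ * Q.ctrlBound * (2 * δ * ρ + ‖(X - Y) * E‖) * (Q.ctrlBound * ‖E‖) := by
      rw [norm_smul, Real.norm_eq_abs]
      gcongr
      · exact (abs_feedback_sub_le hK hV hW X Y k).trans (by gcongr; exact pdist_nonneg E X 1)
      · refine (Matrix.frobenius_norm_mul _ _).trans ?_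
        rw [norm_unitary_mul hX]
        gcongr
        exact norm_Stilde_le hV k
    have b2 : ‖feedback Q E K W Y k • ((Stilde Q V k - Stilde Q W k) * (X * E))‖ ≤
        2 * K * ‖E‖ * Q.ctrlBound * ρ * (2 * Q.ctrlBound * δ * ‖E‖) := by
      rw [norm_smul, Real.norm_eq_abs]
      gcongr
      · exact (abs_feedback_le hK hW Y k).trans (by gcongr)
      · refine (Matrix.frobenius_norm_mul _ _).trans ?_
        rw [norm_unitary_mul hX]
        gcongr
        exact (norm_Stilde_sub_le hV hW k).trans (by gcongr)
    have b3 : ‖feedback Q E K W Y k • (Stilde Q W k * ((X - Y) * E))‖ ≤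
        2 * K * ‖E‖ * Q.ctrlBound * (2 * ‖E‖) * (Q.ctrlBound * ‖(X - Y) * E‖) := by
      rw [norm_smul, Real.norm_eq_abs]
      gcongr
      · exact (abs_feedback_le hK hW Y k).trans (by gcongr)
      · refine (Matrix.frobenius_norm_mul _ _).trans ?_
        gcongr
        exact norm_Stilde_le hW k
    -- The three bounds add up to `6` times the distance term and `8` times the `δ * ρ` term, whence
    -- the `8` in `errorRate`.
    refine norm_add₃_le.trans ((add_le_add (add_le_add b1 b2) b3).trans ?_)
    have h1 : 0 ≤ K * ‖E‖ ^ 2 * Q.ctrlBound ^ 2 * ‖(X - Y) * E‖ := by positivity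
    have h2 : 0 ≤ K * ‖E‖ ^ 2 * Q.ctrlBound ^ 2 * (δ * ρ) := by positivity
    nlinarith [h1, h2]
  rw [e]
  refine (norm_sum_le_of_le _ fun k _ => b k).trans ?_
  have h1 : 0 ≤ ‖(X - Y) * E‖ + δ * ρ := by positivity
  simp only [Finset.sum_const, Finset.card_univ, Fintype.card_fin, nsmul_eq_mul, errorRate]
  nlinarith [h1]

/-- Solutions of the error systems along nearby reference trajectories stay close, relatively to
the initial distance to the identity. -/
theorem norm_errorSolution_sub_le (hE : Eᴴ * E = 1) (hK : 0 < K) {s δ : ℝ} (hs : 0 ≤ s)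
    (hXbar : ∀ t ∈ Icc 0 s, Xbar t ∈ Matrix.unitaryGroup (Fin n) ℂ)
    (hYbar : ∀ t ∈ Icc 0 s, Ybar t ∈ Matrix.unitaryGroup (Fin n) ℂ)
    (hδ : ∀ t ∈ Icc 0 s, ‖Xbar t - Ybar t‖ ≤ δ)
    (hX : IsErrorSolution Q E K s Xbar Xt) (hY : IsErrorSolution Q E K s Ybar Yt)
    (h0 : Xt 0 = Yt 0) (hu : Yt 0 ∈ Matrix.unitaryGroup (Fin n) ℂ) :
    ‖(Xt s - Yt s) * E‖ ≤ δ * pdist E (Yt 0) 1 * Real.exp (errorRate Q E K * s) := by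
  have h0s : (0 : ℝ) ∈ Icc 0 s := ⟨le_rfl, hs⟩
  have hδ0 : 0 ≤ δ := (norm_nonneg _).trans (hδ 0 h0s)
  have hux : Xt 0 ∈ Matrix.unitaryGroup (Fin n) ℂ := h0 ▸ hu
  have hd : ∀ t ∈ Icc 0 s, HasDerivWithinAt (fun t => (Xt t - Yt t) * E)
      (errorGen Q E K (Xbar t) (Xt t) * Xt t * E - errorGen Q E K (Ybar t) (Yt t) * Yt t * E)
      (Icc 0 s) t := fun t ht => by
    have := hasDerivWithinAt_mul_const ((hX t ht).sub (hY t ht)) E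
    rwa [Matrix.sub_mul] at this
  have hr := errorRate_pos (Q := Q) (E := E) hK.le
  -- Both partial distances only decrease, so the initial one serves as `ρ` for all times.
  have key := norm_le_gronwallBound_of_norm_deriv_right_le (δ := 0)
    (K := errorRate Q E K) (ε := errorRate Q E K * (δ * pdist E (Yt 0) 1))
    (fun t ht => (hd t ht).continuousWithinAt)
    (fun t ht => ((hd t (Ico_subset_Icc_self ht)).mono_of_mem_nhdsWithin
      (Icc_mem_nhdsGE_of_mem ht))) (by simp [h0])
    (fun t ht => by
      have ht' := Ico_subset_Icc_self ht
      exact norm_errorGen_mul_sub_le hK.le (hXbar t ht') (hYbar t ht')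
        (hX.mem_unitaryGroup hux t ht') (hY.mem_unitaryGroup hu t ht') (hδ t ht')
        (by simpa only [h0] using hX.pdist_antitoneOn hE hK hux h0s ht' ht'.1)
        (hY.pdist_antitoneOn hE hK hu h0s ht' ht'.1)) s ⟨hs, le_rfl⟩
  rw [gronwallBound_of_K_ne_0 hr.ne'] at key
  refine key.trans ?_
  beta_reduce
  rw [zero_mul, zero_add, mul_div_cancel_left₀ _ hr.ne', sub_zero]
  have := pdist_nonneg E (Yt 0) 1
  gcongr
  linarith

end Perturbation

/-! ### Recurrence of powers and splitting of the horizon. -/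

section Recurrence

theorem norm_pow_sub_one_le {P : Matrix (Fin n) (Fin n) ℂ}
    (hP : P ∈ Matrix.unitaryGroup (Fin n) ℂ) (k : ℕ) : ‖P ^ k - 1‖ ≤ k * ‖P - 1‖ := by
  induction k with
  | zero => simp
  | succ k ih =>
    have e : P ^ (k + 1) - 1 = P ^ k * (P - 1) + (P ^ k - 1) := by
      rw [pow_succ, Matrix.mul_sub, Matrix.mul_one]; abel
    rw [e]
    refine (norm_add_le _ _).trans ?_
    rw [norm_unitary_mul (pow_mem hP k)]
    push_cast
    linarith

/-- The powers of a unitary matrix return arbitrarily close to the identity. -/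
theorem exists_norm_pow_sub_one_le {P : Matrix (Fin n) (Fin n) ℂ}
    (hP : P ∈ Matrix.unitaryGroup (Fin n) ℂ) {δ : ℝ} (hδ : 0 < δ) :
    ∃ p : ℕ, 1 ≤ p ∧ ‖P ^ p - 1‖ ≤ δ := by
  have : ProperSpace (Matrix (Fin n) (Fin n) ℂ) := FiniteDimensional.proper ℂ _
  have hb : ∀ k, P ^ k ∈ Metric.closedBall 0 ‖(1 : Matrix (Fin n) (Fin n) ℂ)‖ := fun k => by
    have := norm_unitary_mul (pow_mem hP k) (1 : Matrix (Fin n) (Fin n) ℂ)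
    rw [Matrix.mul_one] at this
    simp [this]
  obtain ⟨A, -, φ, hφ, hA⟩ := (isCompact_closedBall _ _).tendsto_subseq hb
  -- Two terms of a convergent subsequence are close; multiplying by the inverse of the earlier
  -- power brings their difference next to the identity.
  obtain ⟨k, hk⟩ := Metric.cauchySeq_iff'.1 hA.cauchySeq δ hδ
  have hlt : φ k < φ (k + 1) := hφ k.lt_succ_self
  refine ⟨φ (k + 1) - φ k, by omega, ?_⟩
  have h := hk (k + 1) k.le_succ
  rw [dist_eq_norm] at h
  simp only [Function.comp] at h
  rw [← norm_unitary_mul (pow_mem hP (φ k)), Matrix.mul_sub, Matrix.mul_one, ← pow_add,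
    Nat.add_sub_cancel' hlt.le]
  exact h.le

theorem exists_eq_nat_mul_add {T T₀ Tf : ℝ} (hT : 0 < T) (h : T₀ < Tf) :
    ∃ (j : ℕ) (s : ℝ), Tf = j * T + s ∧ T₀ < s ∧ s ≤ T₀ + T := by
  have hpos : 0 < (Tf - T₀) / T := div_pos (by linarith) hT
  -- Taking the ceiling minus one, rather than the floor, makes `T₀ < s` strict, as attractivity of
  -- the seed requires.
  obtain ⟨j, hj⟩ := Nat.exists_eq_succ_of_ne_zero (Nat.ceil_pos.2 hpos).ne'
  have h1 := Nat.ceil_lt_add_one hpos.le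
  have h2 := Nat.le_ceil ((Tf - T₀) / T)
  rw [hj, Nat.succ_eq_add_one, Nat.cast_add, Nat.cast_one] at h1 h2
  rw [add_lt_add_iff_right, lt_div_iff₀ hT] at h1
  rw [div_le_iff₀ hT] at h2
  exact ⟨j, Tf - j * T, by ring, by linarith, by linarith⟩

end Recurrence

/-! ### Periodicity of the seed and Floquet theory. -/

section Seed

theorem seedInput_add_period {T : ℝ} (hT : T ≠ 0) {M : ℕ} (a b : Fin m → Fin M → ℝ) (t : ℝ) :
    seedInput T a b (T + t) = seedInput T a b t := by
  funext k
  refine Finset.sum_congr rfl fun j _ => ?_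
  have e : 2 * ((j : ℝ) + 1) * Real.pi * (T + t) / T =
      2 * ((j : ℝ) + 1) * Real.pi * t / T + ((j + 1 : ℕ) : ℝ) * (2 * Real.pi) := by
    push_cast; field_simp; ring
  rw [e, Real.sin_add_nat_mul_two_pi, Real.cos_add_nat_mul_two_pi]

theorem continuous_seedInput (T : ℝ) {M : ℕ} (a b : Fin m → Fin M → ℝ) :
    Continuous (seedInput T a b) := by
  unfold seedInput
  fun_prop

/-- Floquet factorization of the propagator of a system with periodic input. -/
theorem QuantumSystem.IsTrajectory.eq_mul_pow {v : ℝ → Fin m → ℝ} {T Tf : ℝ} (hT : 0 < T)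
    (hv : ∀ t, v (T + t) = v t) {X Φ : ℝ → Matrix (Fin n) (Fin n) ℂ}
    (hX : Q.IsTrajectory Tf v X) (hX0 : X 0 = 1) (hΦ : Q.IsTrajectory T v Φ) (hΦ0 : Φ 0 = 1)
    (i : ℕ) {t : ℝ} (ht : 0 ≤ t) (hit : i * T + t ≤ Tf) : X (i * T + t) = X t * Φ T ^ i := by
  have hstep : ∀ t, 0 ≤ t → T + t ≤ Tf → X (T + t) = X t * Φ T := fun t ht htT => by
    -- Uniqueness over one period; the shifted trajectory then solves the same equation, with
    -- initial value `Φ T`.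
    have hP : X T = Φ T := by
      have := hΦ.eq_mul (hX.mono (by linarith)) hΦ0 T ⟨hT.le, le_rfl⟩
      rwa [hX0, Matrix.mul_one] at this
    have h1 : Q.IsTrajectory (Tf - T) v (fun t => X (T + t)) :=
      (hX.shift hT.le (by linarith)).congr fun t _ => hv t
    have := (hX.mono (by linarith : Tf - T ≤ Tf)).eq_mul h1 hX0 t ⟨ht, by linarith⟩
    rwa [add_zero, hP] at this
  induction i with
  | zero => simp
  | succ i ih =>
    have hi : (0 : ℝ) ≤ i * T := by positivity
    push_cast at hit ⊢
    rw [show ((i : ℝ) + 1) * T + t = T + (i * T + t) by ring, hstep _ (by linarith) (by linarith),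
      ih (by linarith), Matrix.mul_assoc, pow_succ]

end Seed

/-! ### Reference trajectories and their stability under perturbation. -/

section Reference

variable {Tf : ℝ} {u : ℝ → Fin m → ℝ} {X : ℝ → Matrix (Fin n) (Fin n) ℂ}
  {G : Matrix (Fin n) (Fin n) ℂ}

theorem refTraj_mem_unitaryGroup (hT : 0 ≤ Tf) (hG : G ∈ Matrix.unitaryGroup (Fin n) ℂ)
    (hX : Q.IsTrajectory Tf u X) (hX0 : X 0 = 1) :
    ∀ t ∈ Icc 0 Tf, refTraj Tf G X t ∈ Matrix.unitaryGroup (Fin n) ℂ := fun t ht =>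
  have hu := hX.mem_unitaryGroup (hX0 ▸ one_mem _)
  mul_mem (hu t ht) (mul_mem (conjTranspose_mem_unitaryGroup (hu Tf ⟨hT, le_rfl⟩)) hG)

theorem refTraj_end (hT : 0 ≤ Tf) (hX : Q.IsTrajectory Tf u X) (hX0 : X 0 = 1) :
    refTraj Tf G X Tf = G := by
  rw [refTraj, ← Matrix.mul_assoc, mul_conjTranspose_self_of_mem
    (hX.mem_unitaryGroup (hX0 ▸ one_mem _) Tf ⟨hT, le_rfl⟩), Matrix.one_mul]

theorem isTrajectory_refTraj (hX : Q.IsTrajectory Tf u X) :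
    Q.IsTrajectory Tf u (refTraj Tf G X) :=
  hX.mul_const _

/-- Unitary trajectories with the same end point and nearby inputs are close. -/
theorem norm_trajectory_sub_le {v : ℝ → Fin m → ℝ} {Y : ℝ → Matrix (Fin n) (Fin n) ℂ} {a η : ℝ}
    (ha : 0 ≤ a) (hX : Q.IsTrajectory Tf u X) (hY : Q.IsTrajectory Tf v Y)
    (hXu : ∀ t ∈ Icc 0 Tf, X t ∈ Matrix.unitaryGroup (Fin n) ℂ)
    (hYu : ∀ t ∈ Icc 0 Tf, Y t ∈ Matrix.unitaryGroup (Fin n) ℂ) (hend : X Tf = Y Tf)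
    (hη : ∀ t ∈ Icc a Tf, ∀ k, |v t k - u t k| ≤ η) :
    ∀ t ∈ Icc a Tf, ‖X t - Y t‖ ≤ Q.ctrlBound * η * (Tf - a) := by
  intro t ht
  have hsub : Icc a Tf ⊆ Icc 0 Tf := Icc_subset_Icc_left ha
  have hT : Tf ∈ Icc a Tf := ⟨ht.1.trans ht.2, le_rfl⟩
  have hd : ∀ x ∈ Icc a Tf, HasDerivWithinAt (fun t => (X t)ᴴ * Y t)
      ((X x)ᴴ * ((Q.gen (v x) - Q.gen (u x)) * Y x)) (Icc a Tf) x := fun x hx => by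
    refine ((hasDerivWithinAt_conjTranspose_mul (hX x (hsub hx)) (hY x (hsub hx))).mono
      hsub).congr_deriv ?_
    rw [Matrix.conjTranspose_mul, Q.conjTranspose_gen, Matrix.sub_mul, Matrix.mul_sub,
      Matrix.mul_neg, Matrix.neg_mul, Matrix.mul_assoc]
    abel
  have hb : ∀ x ∈ Icc a Tf, ‖(X x)ᴴ * ((Q.gen (v x) - Q.gen (u x)) * Y x)‖ ≤
      Q.ctrlBound * η := fun x hx => by
    rw [norm_unitary_mul (conjTranspose_mem_unitaryGroup (hXu x (hsub hx))),
      norm_mul_unitary (hYu x (hsub hx)), Q.gen_sub_gen, QuantumSystem.ctrlBound, Finset.sum_mul]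
    refine norm_sum_le_of_le _ fun k _ => ?_
    rw [norm_smul, Real.norm_eq_abs, mul_comm]
    gcongr
    exact hη x hx k
  -- In the derivative of `(X t)ᴴ * Y t` the drift cancels. The product equals `1` at `Tf`, so the
  -- mean value inequality is applied backwards from the common end point.
  have key := (convex_Icc a Tf).norm_image_sub_le_of_norm_hasDerivWithin_le hd hb ht hT
  rw [← hend, conjTranspose_mul_self_of_mem (hXu Tf (hsub hT)),
    ← conjTranspose_mul_self_of_mem (hXu t (hsub ht)), ← Matrix.mul_sub,
    norm_unitary_mul (conjTranspose_mem_unitaryGroup (hXu t (hsub ht))), Real.norm_eq_abs,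
    abs_of_nonneg (by linarith [ht.2])] at key
  refine key.trans ?_
  have hC := (norm_nonneg _).trans (hb t ht)
  exact mul_le_mul_of_nonneg_left (by linarith [ht.1]) hC

end Reference

/-- Attractivity of a reference trajectory is inherited, with a slightly larger factor, by nearby
reference trajectories. -/
theorem pdist_le_of_isAttractive_of_close (hE : Eᴴ * E = 1) (hK : 0 < K) {c lam s S δ : ℝ}
    {Xbar Ybar Yt : ℝ → Matrix (Fin n) (Fin n) ℂ} (hs : 0 ≤ s) (hsS : s ≤ S)
    (hatt : IsAttractive Q E K s c lam Xbar) (hc : ContinuousOn Xbar (Icc 0 s))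
    (hXbar : ∀ t ∈ Icc 0 s, Xbar t ∈ Matrix.unitaryGroup (Fin n) ℂ)
    (hYbar : ∀ t ∈ Icc 0 s, Ybar t ∈ Matrix.unitaryGroup (Fin n) ℂ)
    (hδ : ∀ t ∈ Icc 0 s, ‖Xbar t - Ybar t‖ ≤ δ)
    (hY : IsErrorSolution Q E K s Ybar Yt) (hu : Yt 0 ∈ Matrix.unitaryGroup (Fin n) ℂ)
    (hYc : pdist E (Yt 0) 1 ≤ c) :
    pdist E (Yt s) 1 ≤ (√lam + δ * Real.exp (errorRate Q E K * S)) * pdist E (Yt 0) 1 := by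
  have h0s : (0 : ℝ) ∈ Icc 0 s := ⟨le_rfl, hs⟩
  have hδ0 : 0 ≤ δ := (norm_nonneg _).trans (hδ 0 h0s)
  -- Comparison solution along the attractive reference, with the same initial error: it contracts
  -- by `√lam`, and Grönwall controls the difference.
  obtain ⟨Xt, hXt0, hX⟩ := exists_isErrorSolution (Q := Q) (E := E) hK.le hs hc hXbar hu
  have hux : Xt 0 ∈ Matrix.unitaryGroup (Fin n) ℂ := hXt0 ▸ hu
  have hinit : (Xbar 0)ᴴ * (Xbar 0 * Yt 0) = Yt 0 := by
    rw [← Matrix.mul_assoc, conjTranspose_mul_self_of_mem (hXbar 0 h0s), Matrix.one_mul]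
  have h1 := hatt.2.2 (Xbar 0 * Yt 0) (mul_mem (hXbar 0 h0s) hu)
    (by rw [hinit]; exact ⟨hu, hYc⟩) Xt hX (by rw [hinit, hXt0])
  rw [lyap_eq_pdist_sq hE (hX.mem_unitaryGroup hux s ⟨hs, le_rfl⟩), lyap_eq_pdist_sq hE hux,
    hXt0] at h1
  have hp := pdist_nonneg E (Yt 0) 1
  have h2 : pdist E (Xt s) 1 ≤ √lam * pdist E (Yt 0) 1 := by
    refine (Real.le_sqrt_of_sq_le h1).trans_eq ?_
    rw [Real.sqrt_mul hatt.1.le, Real.sqrt_sq hp]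
  have h3 := norm_errorSolution_sub_le hE hK hs hXbar hYbar hδ hX hY hXt0 hu
  have h4 : pdist E (Yt s) 1 ≤ pdist E (Xt s) 1 + ‖(Xt s - Yt s) * E‖ := by
    have e : (Yt s - 1) * E = (Xt s - 1) * E - (Xt s - Yt s) * E := by
      simp only [Matrix.sub_mul]; abel
    rw [pdist, e]
    exact norm_sub_le _ _
  have h5 : Real.exp (errorRate Q E K * s) ≤ Real.exp (errorRate Q E K * S) := by
    have := (errorRate_pos (Q := Q) (E := E) hK.le).le
    gcongr
  have h6 : δ * pdist E (Yt 0) 1 * Real.exp (errorRate Q E K * s) ≤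
      δ * pdist E (Yt 0) 1 * Real.exp (errorRate Q E K * S) := by gcongr
  linarith

/-! ### The error of a run. -/

section Run

variable {Tf : ℝ} {seed : ℝ → Fin m → ℝ} {G : Matrix (Fin n) (Fin n) ℂ}
  {u : ℕ → ℝ → Fin m → ℝ} {X : ℕ → ℝ → Matrix (Fin n) (Fin n) ℂ}

/-- The error `X̃^{ℓ+1} = (X̄^ℓ)† X^{ℓ+1}` of a run with the constant goal `G`. -/
noncomputable def runError (Tf : ℝ) (G : Matrix (Fin n) (Fin n) ℂ)
    (X : ℕ → ℝ → Matrix (Fin n) (Fin n) ℂ) (ℓ : ℕ) (t : ℝ) : Matrix (Fin n) (Fin n) ℂ :=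
  (refTraj Tf G (X ℓ) t)ᴴ * X (ℓ + 1) t

theorem IsRun.mem_unitaryGroup (hrun : IsRun Q E K Tf seed (fun _ => G) u X)
    (ℓ : ℕ) :
    ∀ t ∈ Icc 0 Tf, X ℓ t ∈ Matrix.unitaryGroup (Fin n) ℂ :=
  (hrun.open_loop ℓ).mem_unitaryGroup (hrun.init ℓ ▸ one_mem _)

theorem IsRun.refTraj_mem (hrun : IsRun Q E K Tf seed (fun _ => G) u X)
    (hT : 0 ≤ Tf) (hG : G ∈ Matrix.unitaryGroup (Fin n) ℂ) (ℓ : ℕ) :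
    ∀ t ∈ Icc 0 Tf, refTraj Tf G (X ℓ) t ∈ Matrix.unitaryGroup (Fin n) ℂ :=
  refTraj_mem_unitaryGroup hT hG (hrun.open_loop ℓ) (hrun.init ℓ)

/-- The reference and the next propagator have inputs differing exactly by the feedback, so drift
and reference input cancel in the derivative of the error. -/
theorem IsRun.isErrorSolution (hrun : IsRun Q E K Tf seed (fun _ => G) u X)
    (hT : 0 ≤ Tf) (hG : G ∈ Matrix.unitaryGroup (Fin n) ℂ) (ℓ : ℕ) :
    IsErrorSolution Q E K Tf (refTraj Tf G (X ℓ)) (runError Tf G X ℓ) := fun t ht => by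
  have hY : refTraj Tf G (X ℓ) t * runError Tf G X ℓ t = X (ℓ + 1) t := by
    rw [runError, ← Matrix.mul_assoc,
      mul_conjTranspose_self_of_mem (hrun.refTraj_mem hT hG ℓ t ht), Matrix.one_mul]
  have h := hasDerivWithinAt_conjTranspose_mul
    (isTrajectory_refTraj (G := G) (hrun.open_loop ℓ) t ht) (hrun.closed_loop ℓ t ht)
  refine h.congr_deriv ?_
  have hgen := Q.gen_sub_gen (fun k => u ℓ t k + feedback Q E K (refTraj Tf G (X ℓ) t)
      (runError Tf G X ℓ t) k) (u ℓ t)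
  simp only [add_sub_cancel_left] at hgen
  rw [Matrix.conjTranspose_mul, Q.conjTranspose_gen, Matrix.mul_neg, Matrix.neg_mul,
    neg_add_eq_sub, Matrix.mul_assoc, ← Matrix.mul_sub, ← Matrix.sub_mul]
  change _ * ((Q.gen (fun k => u ℓ t k + feedback Q E K (refTraj Tf G (X ℓ) t)
      (runError Tf G X ℓ t) k) - Q.gen (u ℓ t)) * X (ℓ + 1) t) = _
  rw [hgen, Finset.sum_mul, Finset.mul_sum, Finset.sum_mul]
  refine Finset.sum_congr rfl fun k _ => ?_
  rw [Matrix.smul_mul, Matrix.mul_smul, Matrix.smul_mul, Stilde,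
    Matrix.mul_assoc _ (refTraj Tf G (X ℓ) t), hY, Matrix.mul_assoc]

/-- Together with `IsRun.runError_end`: with a constant goal, each step starts at the error with
which the previous one ended. -/
theorem IsRun.runError_zero (hrun : IsRun Q E K Tf seed (fun _ => G) u X)
    (ℓ : ℕ) : runError Tf G X ℓ 0 = Gᴴ * X ℓ Tf := by
  rw [runError, refTraj, hrun.init, hrun.init, Matrix.one_mul, Matrix.mul_one,
    Matrix.conjTranspose_mul, Matrix.conjTranspose_conjTranspose]

theorem IsRun.runError_end (hrun : IsRun Q E K Tf seed (fun _ => G) u X)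
    (hT : 0 ≤ Tf) (ℓ : ℕ) :
    runError Tf G X ℓ Tf = Gᴴ * X (ℓ + 1) Tf := by
  rw [runError, refTraj_end hT (hrun.open_loop ℓ) (hrun.init ℓ)]

theorem IsRun.runError_zero_mem (hrun : IsRun Q E K Tf seed (fun _ => G) u X)
    (hT : 0 ≤ Tf) (hG : G ∈ Matrix.unitaryGroup (Fin n) ℂ) (ℓ : ℕ) :
    runError Tf G X ℓ 0 ∈ Matrix.unitaryGroup (Fin n) ℂ := by
  rw [hrun.runError_zero]
  exact mul_mem (conjTranspose_mem_unitaryGroup hG) (hrun.mem_unitaryGroup ℓ Tf ⟨hT, le_rfl⟩)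

theorem pdist_conjTranspose_mul_one (hG : G ∈ Matrix.unitaryGroup (Fin n) ℂ)
    (Y : Matrix (Fin n) (Fin n) ℂ) : pdist E (Gᴴ * Y) 1 = pdist E Y G := by
  rw [← conjTranspose_mul_self_of_mem hG, pdist_mul_left (conjTranspose_mem_unitaryGroup hG)]

theorem IsRun.abs_update_sub_le (hrun : IsRun Q E K Tf seed (fun _ => G) u X)
    (hK : 0 ≤ K) (hT : 0 ≤ Tf)
    (hG : G ∈ Matrix.unitaryGroup (Fin n) ℂ) (ℓ : ℕ) {t : ℝ} (ht : t ∈ Icc 0 Tf) (k : Fin m) :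
    |u (ℓ + 1) t k - u ℓ t k| ≤
      2 * K * ‖E‖ * Q.ctrlBound * pdist E (runError Tf G X ℓ t) 1 := by
  rw [hrun.update ℓ t ht k, add_sub_cancel_left]
  exact abs_feedback_le hK (hrun.refTraj_mem hT hG ℓ t ht) _ k

/-- Telescope the corrections and sum the geometric series. The bound is pointwise in `t`, so it
serves both for the last window and for the whole horizon. -/
theorem IsRun.abs_input_sub_le (hrun : IsRun Q E K Tf seed (fun _ => G) u X)
    (hK : 0 ≤ K) (hT : 0 ≤ Tf)
    (hG : G ∈ Matrix.unitaryGroup (Fin n) ℂ) (ℓ : ℕ) {t : ℝ} (ht : t ∈ Icc 0 Tf) (k : Fin m)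
    {C r : ℝ} (hC : 0 ≤ C) (hr0 : 0 ≤ r) (hr1 : r < 1)
    (h : ∀ i < ℓ, pdist E (runError Tf G X i t) 1 ≤ C * r ^ i) :
    |u ℓ t k - u 0 t k| ≤ 2 * K * ‖E‖ * Q.ctrlBound * (C / (1 - r)) := by
  have hB : 0 ≤ 2 * K * ‖E‖ * Q.ctrlBound := by
    have := Q.ctrlBound_nonneg
    positivity
  have h1 : |u ℓ t k - u 0 t k| ≤
      ∑ i ∈ Finset.range ℓ, 2 * K * ‖E‖ * Q.ctrlBound * (C * r ^ i) := by
    rw [← Finset.sum_range_sub (fun i => u i t k)]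
    refine (Finset.abs_sum_le_sum_abs _ _).trans (Finset.sum_le_sum fun i hi => ?_)
    exact (hrun.abs_update_sub_le hK hT hG i ht k).trans
      (mul_le_mul_of_nonneg_left (h i (Finset.mem_range.1 hi)) hB)
  refine h1.trans ?_
  rw [← Finset.mul_sum, ← Finset.mul_sum, div_eq_mul_inv]
  gcongr
  rw [← tsum_geometric_of_lt_one hr0 hr1]
  exact (summable_geometric_of_lt_one hr0 hr1).sum_le_tsum _ fun i _ => by positivity

end Run

/-! ### Windows, translations by periods and contraction. -/

/-- Contractions over successive windows multiply. -/
theorem IsErrorSolution.pdist_le_pow_mul (hE : Eᴴ * E = 1) (hK : 0 < K) {Tf : ℝ}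
    {Xbar Xt : ℝ → Matrix (Fin n) (Fin n) ℂ} (h : IsErrorSolution Q E K Tf Xbar Xt)
    (h0 : Xt 0 ∈ Matrix.unitaryGroup (Fin n) ℂ) {t₀ s τ r : ℝ} (ht₀ : 0 ≤ t₀) (hs : 0 ≤ s)
    (hsτ : s ≤ τ) (hr : 0 ≤ r) (N : ℕ) (hN : t₀ + N * τ ≤ Tf)
    (hw : ∀ k < N, pdist E (Xt (t₀ + k * τ + s)) 1 ≤ r * pdist E (Xt (t₀ + k * τ)) 1) :
    pdist E (Xt (t₀ + N * τ)) 1 ≤ r ^ N * pdist E (Xt 0) 1 := by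
  have hmono := h.pdist_antitoneOn hE hK h0
  have hτ : 0 ≤ τ := hs.trans hsτ
  induction N with
  | zero =>
    simp only [Nat.cast_zero, zero_mul, add_zero] at hN ⊢
    simpa using hmono ⟨le_rfl, ht₀.trans hN⟩ ⟨ht₀, hN⟩ ht₀
  | succ N ih =>
    push_cast at hN ⊢
    have hNτ : 0 ≤ N * τ := by positivity
    have h1 := ih (by linarith) fun k hk => hw k (hk.trans N.lt_succ_self)
    have h2 := hw N N.lt_succ_self
    -- In the gap between the end of a window and the start of the next one the distance cannot
    -- grow.
    have h3 : pdist E (Xt (t₀ + (N + 1) * τ)) 1 ≤ pdist E (Xt (t₀ + N * τ + s)) 1 :=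
      hmono ⟨by linarith, by linarith⟩ ⟨by linarith, hN⟩ (by linarith)
    calc _ ≤ r * pdist E (Xt (t₀ + N * τ)) 1 := h3.trans h2
      _ ≤ r * (r ^ N * pdist E (Xt 0) 1) := by gcongr
      _ = _ := by rw [pow_succ]; ring

/-- Over a window that starts at a multiple of the period, the reference trajectory of a periodic
input is a translation of the reference trajectory of the last window. -/
theorem norm_refTraj_sub_refTraj_shift {v : ℝ → Fin m → ℝ} {T Tf s : ℝ} (hT : 0 < T)
    (hv : ∀ t, v (T + t) = v t) {X Φ : ℝ → Matrix (Fin n) (Fin n) ℂ}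
    {G : Matrix (Fin n) (Fin n) ℂ} (hG : G ∈ Matrix.unitaryGroup (Fin n) ℂ)
    (hX : Q.IsTrajectory Tf v X) (hX0 : X 0 = 1) (hΦ : Q.IsTrajectory T v Φ) (hΦ0 : Φ 0 = 1)
    {i j : ℕ} (hij : i ≤ j) (hTf : Tf = j * T + s) {t : ℝ} (ht : t ∈ Icc 0 s) :
    ‖refTraj s G X t - refTraj Tf G X (i * T + t)‖ = ‖Φ T ^ (j - i) - 1‖ := by
  have hs : 0 ≤ s := ht.1.trans ht.2
  have hij' : (i : ℝ) * T ≤ j * T := by gcongr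
  have hi0 : (0 : ℝ) ≤ i * T := by positivity
  have hP : Φ T ∈ Matrix.unitaryGroup (Fin n) ℂ :=
    hΦ.mem_unitaryGroup (hΦ0 ▸ one_mem _) T ⟨hT.le, le_rfl⟩
  have hXu := hX.mem_unitaryGroup (hX0 ▸ one_mem _)
  have e1 := hX.eq_mul_pow hT hv hX0 hΦ hΦ0 i ht.1 (by linarith [ht.2])
  have e2 := hX.eq_mul_pow hT hv hX0 hΦ hΦ0 j hs hTf.ge
  -- By Floquet, `X (i * T + t)` is `X t * Φ T ^ i` and `X Tf` is `X s * Φ T ^ j`. Everything but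
  -- the difference of two powers is a unitary factor.
  have e : refTraj s G X t - refTraj Tf G X (i * T + t) =
      X t * (((Φ T ^ j - Φ T ^ i) * (Φ T ^ j)ᴴ) * ((X s)ᴴ * G)) := by
    rw [Matrix.sub_mul, mul_conjTranspose_self_of_mem (pow_mem hP j), refTraj, refTraj, e1, hTf,
      e2, Matrix.conjTranspose_mul]
    simp only [Matrix.sub_mul, Matrix.mul_sub, Matrix.one_mul, Matrix.mul_assoc]
  have e3 : Φ T ^ j - Φ T ^ i = Φ T ^ i * (Φ T ^ (j - i) - 1) := by
    rw [Matrix.mul_sub, Matrix.mul_one, ← pow_add, Nat.add_sub_cancel' hij]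
  rw [e, norm_unitary_mul (hXu t ⟨ht.1, by linarith [ht.2]⟩),
    norm_mul_unitary (mul_mem (conjTranspose_mem_unitaryGroup (hXu s ⟨hs, by linarith⟩)) hG),
    norm_mul_unitary (conjTranspose_mem_unitaryGroup (pow_mem hP j)), e3,
    norm_unitary_mul (pow_mem hP i)]

/-- Every solution of the error system along `Xbar` that starts in the ball of radius `c` has its
partial distance to the identity reduced by the factor `r` over `[0, Tf]`. -/
def Contracts (Q : QuantumSystem n m) (E : Matrix (Fin n) (Fin nbar) ℂ) (K Tf c r : ℝ)
    (Xbar : ℝ → Matrix (Fin n) (Fin n) ℂ) : Prop :=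
  ∀ Xt : ℝ → Matrix (Fin n) (Fin n) ℂ, IsErrorSolution Q E K Tf Xbar Xt →
    Xt 0 ∈ Matrix.unitaryGroup (Fin n) ℂ → pdist E (Xt 0) 1 ≤ c →
      pdist E (Xt Tf) 1 ≤ r * pdist E (Xt 0) 1

theorem Contracts.isAttractive (hE : Eᴴ * E = 1) {Tf c r : ℝ} (hT : 0 ≤ Tf) (hr0 : 0 < r)
    (hr1 : r < 1) {Xbar : ℝ → Matrix (Fin n) (Fin n) ℂ} (h : Contracts Q E K Tf c r Xbar) :
    IsAttractive Q E K Tf c (r ^ 2) Xbar := by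
  refine ⟨by positivity, by nlinarith, fun X₀ _ hball Xt hXt hinit => ?_⟩
  rw [← hinit] at hball
  rw [lyap_eq_pdist_sq hE (hXt.mem_unitaryGroup hball.1 Tf ⟨hT, le_rfl⟩),
    lyap_eq_pdist_sq hE hball.1, ← mul_pow]
  have := h Xt hXt hball.1 hball.2
  exact pow_le_pow_left₀ (pdist_nonneg _ _ _) this 2

/-- Contraction along reference trajectories near that of the seed on the last window. -/
theorem contracts_of_close (hE : Eᴴ * E = 1) (hK : 0 < K) {Tf a s c r : ℝ} (ha : 0 ≤ a)
    (hs : 0 ≤ s) (has : Tf = a + s) {Ybar : ℝ → Matrix (Fin n) (Fin n) ℂ}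
    (hwin : ∀ Yt, IsErrorSolution Q E K s (fun t => Ybar (a + t)) Yt →
      Yt 0 ∈ Matrix.unitaryGroup (Fin n) ℂ → pdist E (Yt 0) 1 ≤ c →
      pdist E (Yt s) 1 ≤ r * pdist E (Yt 0) 1) (hr : 0 ≤ r) :
    Contracts Q E K Tf c r Ybar := fun Xt hXt h0 hc => by
  have hmem : a ∈ Icc 0 Tf := ⟨ha, by linarith⟩
  have h1 : pdist E (Xt a) 1 ≤ pdist E (Xt 0) 1 :=
    hXt.pdist_antitoneOn hE hK h0 ⟨le_rfl, by linarith⟩ hmem ha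
  have h2 := hwin _ (hXt.shift ha has.ge) (by simpa using hXt.mem_unitaryGroup h0 a hmem)
    (by simpa using h1.trans hc)
  simp only [add_zero, ← has] at h2
  exact h2.trans (by gcongr)

/-! ### Propagation of contraction from step to step. -/

section Run

variable {Tf : ℝ} {seed : ℝ → Fin m → ℝ} {G : Matrix (Fin n) (Fin n) ℂ}
  {u : ℕ → ℝ → Fin m → ℝ} {X : ℕ → ℝ → Matrix (Fin n) (Fin n) ℂ} {c r : ℝ}

theorem IsRun.pdist_runError_zero (hrun : IsRun Q E K Tf seed (fun _ => G) u X)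
    (hG : G ∈ Matrix.unitaryGroup (Fin n) ℂ) (ℓ : ℕ) :
    pdist E (runError Tf G X ℓ 0) 1 = pdist E (X ℓ Tf) G := by
  rw [hrun.runError_zero, pdist_conjTranspose_mul_one hG]

theorem IsRun.pdist_runError_end (hrun : IsRun Q E K Tf seed (fun _ => G) u X) (hT : 0 ≤ Tf)
    (hG : G ∈ Matrix.unitaryGroup (Fin n) ℂ) (ℓ : ℕ) :
    pdist E (runError Tf G X ℓ Tf) 1 = pdist E (X (ℓ + 1) Tf) G := by
  rw [hrun.runError_end hT, pdist_conjTranspose_mul_one hG]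

theorem IsRun.pdist_succ_le (hrun : IsRun Q E K Tf seed (fun _ => G) u X) (hT : 0 ≤ Tf)
    (hG : G ∈ Matrix.unitaryGroup (Fin n) ℂ) {ℓ : ℕ}
    (h : Contracts Q E K Tf c r (refTraj Tf G (X ℓ))) (hc : pdist E (X ℓ Tf) G ≤ c) :
    pdist E (X (ℓ + 1) Tf) G ≤ r * pdist E (X ℓ Tf) G := by
  have := h _ (hrun.isErrorSolution hT hG ℓ) (hrun.runError_zero_mem hT hG ℓ)
    ((hrun.pdist_runError_zero hG ℓ).trans_le hc)
  rwa [hrun.pdist_runError_zero hG, hrun.pdist_runError_end hT hG] at this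

/-- Only the steps before `ℓ` are assumed to contract, so that this can be used inside the induction
of `IsRun.contracts`. -/
theorem IsRun.pdist_le_pow (hrun : IsRun Q E K Tf seed (fun _ => G) u X) (hT : 0 ≤ Tf)
    (hG : G ∈ Matrix.unitaryGroup (Fin n) ℂ) (hr0 : 0 ≤ r) (hr1 : r ≤ 1) {ℓ : ℕ}
    (h : ∀ i < ℓ, Contracts Q E K Tf c r (refTraj Tf G (X i))) (hc : pdist E (X 0 Tf) G ≤ c) :
    pdist E (X ℓ Tf) G ≤ r ^ ℓ * pdist E (X 0 Tf) G := by
  induction ℓ with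
  | zero => simp
  | succ ℓ ih =>
    have h1 := ih fun i hi => h i (hi.trans ℓ.lt_succ_self)
    have hp := pdist_nonneg E (X 0 Tf) G
    have h2 : pdist E (X ℓ Tf) G ≤ c :=
      h1.trans ((mul_le_of_le_one_left hp (pow_le_one₀ hr0 hr1)).trans hc)
    refine (hrun.pdist_succ_le hT hG (h ℓ ℓ.lt_succ_self) h2).trans ?_
    rw [pow_succ', mul_assoc]
    gcongr

theorem IsRun.pdist_runError_le (hE : Eᴴ * E = 1) (hK : 0 < K)
    (hrun : IsRun Q E K Tf seed (fun _ => G) u X) (hT : 0 ≤ Tf)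
    (hG : G ∈ Matrix.unitaryGroup (Fin n) ℂ) (ℓ : ℕ) {t : ℝ} (ht : t ∈ Icc 0 Tf) :
    pdist E (runError Tf G X ℓ t) 1 ≤ pdist E (X ℓ Tf) G := by
  rw [← hrun.pdist_runError_zero hG]
  exact (hrun.isErrorSolution hT hG ℓ).pdist_antitoneOn hE hK (hrun.runError_zero_mem hT hG ℓ)
    ⟨le_rfl, hT⟩ ht ht.1

/-- If the first error is small from time `a` on, then all reference trajectories of the run stay
close to the first one on `[a, Tf]`, and hence contract. -/
theorem IsRun.contracts (hE : Eᴴ * E = 1) (hK : 0 < K)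
    (hrun : IsRun Q E K Tf seed (fun _ => G) u X) (hG : G ∈ Matrix.unitaryGroup (Fin n) ℂ)
    {a δ ε : ℝ} (ha : 0 ≤ a) (haT : a ≤ Tf) (hr0 : 0 < r) (hr1 : r < 1) (hε : 0 ≤ ε)
    (hc : pdist E (X 0 Tf) G ≤ c)
    (hclose : ∀ ℓ, (∀ t ∈ Icc a Tf, ‖refTraj Tf G (X 0) t - refTraj Tf G (X ℓ) t‖ ≤ δ) →
      Contracts Q E K Tf c r (refTraj Tf G (X ℓ)))
    (hsmall : pdist E (runError Tf G X 0 a) 1 ≤ ε)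
    (hεδ : Q.ctrlBound * (2 * K * ‖E‖ * Q.ctrlBound * (ε / r / (1 - r))) * (Tf - a) ≤ δ)
    (ℓ : ℕ) : Contracts Q E K Tf c r (refTraj Tf G (X ℓ)) := by
  have hT : 0 ≤ Tf := ha.trans haT
  induction ℓ using Nat.strong_induction_on with
  | _ ℓ ih =>
  -- The first step already ends within `ε` of the goal, because its error is at most `ε` from time
  -- `a` on; each later step gains a factor `r`.
  have hd : ∀ i, i + 1 ≤ ℓ → pdist E (X (i + 1) Tf) G ≤ ε * r ^ i := by
    intro i
    induction i with
    | zero =>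
      intro _
      rw [pow_zero, mul_one, ← hrun.pdist_runError_end hT hG]
      exact ((hrun.isErrorSolution hT hG 0).pdist_antitoneOn hE hK
        (hrun.runError_zero_mem hT hG 0) ⟨ha, haT⟩ ⟨hT, le_rfl⟩ haT).trans hsmall
    | succ i hi =>
      intro hiℓ
      have h1 := hrun.pdist_le_pow hT hG hr0.le hr1.le (ℓ := i + 1)
        (fun k hk => ih k (by omega)) hc
      have h2 : pdist E (X (i + 1) Tf) G ≤ c :=
        h1.trans ((mul_le_of_le_one_left (pdist_nonneg _ _ _)
          (pow_le_one₀ hr0.le hr1.le)).trans hc)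
      refine (hrun.pdist_succ_le hT hG (ih (i + 1) (by omega)) h2).trans ?_
      calc r * pdist E (X (i + 1) Tf) G ≤ r * (ε * r ^ i) := by
            gcongr
            exact hi (by omega)
        _ = ε * r ^ (i + 1) := by rw [pow_succ]; ring
  -- The exponent in `hd` lags by one, hence the constant `ε / r`; since `r < 1`, it also covers
  -- step `0`, where only `ε` is known.
  have hb : ∀ t ∈ Icc a Tf, ∀ i < ℓ, pdist E (runError Tf G X i t) 1 ≤ ε / r * r ^ i := by
    intro t ht i hi
    have ht' : t ∈ Icc 0 Tf := ⟨ha.trans ht.1, ht.2⟩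
    cases i with
    | zero =>
      rw [pow_zero, mul_one]
      refine ((hrun.isErrorSolution hT hG 0).pdist_antitoneOn hE hK
        (hrun.runError_zero_mem hT hG 0) ⟨ha, haT⟩ ht' ht.1).trans (hsmall.trans ?_)
      exact le_div_self hε hr0 hr1.le
    | succ i =>
      refine (hrun.pdist_runError_le hE hK hT hG (i + 1) ht').trans
        ((hd i (by omega)).trans_eq ?_)
      rw [pow_succ]; field_simp
  refine hclose ℓ fun t ht => ?_
  refine (norm_trajectory_sub_le ha (isTrajectory_refTraj (hrun.open_loop 0))
    (isTrajectory_refTraj (hrun.open_loop ℓ)) (hrun.refTraj_mem hT hG 0)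
    (hrun.refTraj_mem hT hG ℓ) ?_ (fun x hx k => ?_) t ht).trans hεδ
  · rw [refTraj_end hT (hrun.open_loop 0) (hrun.init 0),
      refTraj_end hT (hrun.open_loop ℓ) (hrun.init ℓ)]
  · exact hrun.abs_input_sub_le hK.le hT hG ℓ ⟨ha.trans hx.1, hx.2⟩ k (by positivity) hr0.le hr1
      (hb x hx)

end Run

/-! ### Choice of the horizon. -/

/-- For long horizons, all reference trajectories of a run contract by a common factor. -/
theorem exists_horizon_contracts (hE : Eᴴ * E = 1) (hK : 0 < K) {c : ℝ} (hc : 0 < c)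
    {G : Matrix (Fin n) (Fin n) ℂ} (hG : G ∈ Matrix.unitaryGroup (Fin n) ℂ)
    {v : ℝ → Fin m → ℝ} (hvc : Continuous v) {T : ℝ} (hT : 0 < T) (hv : ∀ t, v (T + t) = v t)
    {lam : ℝ} {T₀ r : ℝ} (hT₀ : 0 ≤ T₀) (hlr : √lam < r) (hr1 : r < 1)
    (hatt : ∀ Tf > T₀, ∀ X₀ : ℝ → Matrix (Fin n) (Fin n) ℂ, Q.IsTrajectory Tf v X₀ → X₀ 0 = 1 →
      IsAttractive Q E K Tf c lam (refTraj Tf G X₀)) :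
    ∃ Tstar : ℝ, 0 ≤ Tstar ∧ ∀ Tf > Tstar, ∀ (u : ℕ → ℝ → Fin m → ℝ)
      (X : ℕ → ℝ → Matrix (Fin n) (Fin n) ℂ), IsRun Q E K Tf v (fun _ => G) u X →
      pdist E (X 0 Tf) G ≤ c → ∀ ℓ, Contracts Q E K Tf c r (refTraj Tf G (X ℓ)) := by
  have hr0 : 0 < r := (Real.sqrt_nonneg _).trans_lt hlr
  set S := T₀ + T with hS
  have hS0 : 0 < S := by positivity
  -- The closeness at which the perturbed factor `√lam + δ * exp` is exactly `r`; `S` bounds the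
  -- window length uniformly in the horizon.
  set δ := (r - √lam) / Real.exp (errorRate Q E K * S) with hδ
  have hδ0 : 0 < δ := div_pos (sub_pos.2 hlr) (Real.exp_pos _)
  have hδr : √lam + δ * Real.exp (errorRate Q E K * S) = r := by
    rw [hδ, div_mul_cancel₀ _ (Real.exp_pos _).ne']; ring
  obtain ⟨ε, hε0, hε⟩ : ∃ ε > 0,
      Q.ctrlBound * (2 * K * ‖E‖ * Q.ctrlBound * (ε / r / (1 - r))) * S ≤ δ := by
    have h1r : 0 < 1 - r := by linarith
    set D := Q.ctrlBound * (2 * K * ‖E‖ * Q.ctrlBound) * S / r / (1 - r) with hD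
    have hD0 : 0 ≤ D := by
      have := Q.ctrlBound_nonneg
      positivity
    refine ⟨δ / (D + 1), by positivity, ?_⟩
    calc _ = D * (δ / (D + 1)) := by rw [hD]; ring
      _ ≤ (D + 1) * (δ / (D + 1)) := by gcongr; linarith
      _ = δ := by field_simp
  -- Number of contracting windows needed to bring the error from `c` down to `ε` before the last
  -- window.
  obtain ⟨N, hN⟩ : ∃ N : ℕ, r ^ N * c ≤ ε := by
    obtain ⟨N, hN⟩ := exists_pow_lt_of_lt_one (div_pos hε0 hc) hr1
    exact ⟨N, by rw [lt_div_iff₀ hc] at hN; exact hN.le⟩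
  obtain ⟨Φ, hΦ0, hΦ⟩ := Q.exists_isTrajectory hT.le hvc.continuousOn
  have hP : Φ T ∈ Matrix.unitaryGroup (Fin n) ℂ :=
    hΦ.mem_unitaryGroup (hΦ0 ▸ one_mem _) T ⟨hT.le, le_rfl⟩
  -- The spacing is `h = q * p` periods: `q` makes it at least `S`, so windows do not overlap, and
  -- `p` is a return time of `Φ T ^ q`. The tolerance is divided by `N + 1` because up to `N`
  -- spacings accumulate.
  obtain ⟨q, hq⟩ := exists_nat_ge (S / T)
  rw [div_le_iff₀ hT] at hq
  obtain ⟨p, hp1, hp⟩ := exists_norm_pow_sub_one_le (pow_mem hP q)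
    (div_pos hδ0 (by positivity : (0 : ℝ) < N + 1))
  rw [← pow_mul] at hp
  set h := q * p with hh
  have hhT : S ≤ h * T := by
    have : (1 : ℝ) ≤ p := by exact_mod_cast hp1
    have hqT : 0 ≤ (q : ℝ) * T := by positivity
    rw [hh]; push_cast
    nlinarith
  -- Room for `N` spacings followed by one last window.
  refine ⟨N * h * T + S, by positivity, fun Tf hTf u X hrun hd0 => ?_⟩
  have hNhT : 0 ≤ N * h * T := by positivity
  have hTf0 : 0 ≤ Tf := by linarith
  obtain ⟨j, s, hjs, hs0, hsS⟩ := exists_eq_nat_mul_add (Tf := Tf) hT (T₀ := T₀) (by linarith)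
  have hs : 0 ≤ s := by linarith
  have hjN : N * h ≤ j := by
    have : (N * h : ℝ) * T < j * T := by linarith
    exact_mod_cast (lt_of_mul_lt_mul_right this hT.le).le
  have hjT : 0 ≤ (j : ℝ) * T := by positivity
  have hX0 : Q.IsTrajectory Tf v (X 0) := (hrun.open_loop 0).congr hrun.seed_eq
  have hX0s : Q.IsTrajectory s v (X 0) := hX0.mono (by linarith)
  have hwin : ∀ Ybar Yt : ℝ → Matrix (Fin n) (Fin n) ℂ,
      (∀ t ∈ Icc 0 s, Ybar t ∈ Matrix.unitaryGroup (Fin n) ℂ) →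
      (∀ t ∈ Icc 0 s, ‖refTraj s G (X 0) t - Ybar t‖ ≤ δ) →
      IsErrorSolution Q E K s Ybar Yt → Yt 0 ∈ Matrix.unitaryGroup (Fin n) ℂ →
      pdist E (Yt 0) 1 ≤ c → pdist E (Yt s) 1 ≤ r * pdist E (Yt 0) 1 := by
    intro Ybar Yt hYu hclose hY hu hYc
    have := pdist_le_of_isAttractive_of_close hE hK hs hsS
      (hatt s hs0 (X 0) hX0s (hrun.init 0))
      (isTrajectory_refTraj hX0s).continuousOn
      (refTraj_mem_unitaryGroup hs hG hX0s (hrun.init 0)) hYu hclose hY hu hYc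
    rwa [hδr] at this
  have hshift : ∀ i ≤ j, ∀ t ∈ Icc 0 s, (i : ℝ) * T + t ∈ Icc 0 Tf := fun i hi t ht => by
    have h1 : (i : ℝ) * T ≤ j * T := by gcongr
    have h2 : 0 ≤ (i : ℝ) * T := by positivity
    exact ⟨by linarith [ht.1], by linarith [ht.2]⟩
  -- The case `i = j`: on the last window the reference coincides with the one of horizon `s`.
  have hlast : ∀ t ∈ Icc 0 s, refTraj s G (X 0) t = refTraj Tf G (X 0) (j * T + t) :=
    fun t ht => by
    have := norm_refTraj_sub_refTraj_shift hT hv hG hX0 (hrun.init 0) hΦ hΦ0 le_rfl hjs ht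
    rwa [Nat.sub_self, pow_zero, sub_self, norm_zero, norm_eq_zero, sub_eq_zero] at this
  have hsmall : pdist E (runError Tf G X 0 (j * T)) 1 ≤ ε := by
    have hsol := hrun.isErrorSolution hTf0 hG 0
    have hsol0 := hrun.runError_zero_mem hTf0 hG 0
    -- Windows start at periods `i₀ + k * h`, counted back from `j`, so that each lies a multiple of
    -- `h` periods before the last window.
    obtain ⟨i₀, hi₀⟩ := Nat.exists_eq_add_of_le' hjN
    have hjT' : (j : ℝ) * T = i₀ * T + N * (h * T) := by rw [hi₀]; push_cast; ring
    have hd0' : pdist E (runError Tf G X 0 0) 1 ≤ c := by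
      rwa [hrun.pdist_runError_zero hG]
    rw [hjT']
    refine (hsol.pdist_le_pow_mul hE hK hsol0 (by positivity) hs (hsS.trans hhT) hr0.le N
      (by linarith) fun k hk => ?_).trans (le_trans (by gcongr) hN)
    have hkj : i₀ + k * h ≤ j := by
      rw [hi₀]
      have := Nat.mul_le_mul_right h hk.le
      omega
    have hcast : (i₀ : ℝ) * T + k * (h * T) = ((i₀ + k * h : ℕ) : ℝ) * T := by push_cast; ring
    have hm : ((i₀ + k * h : ℕ) : ℝ) * T ∈ Icc 0 Tf := by
      simpa using hshift _ hkj 0 ⟨le_rfl, hs⟩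
    have hms : ((i₀ + k * h : ℕ) : ℝ) * T + s ≤ Tf := (hshift _ hkj s ⟨hs, le_rfl⟩).2
    rw [hcast]
    have := hwin (fun t => refTraj Tf G (X 0) (((i₀ + k * h : ℕ) : ℝ) * T + t))
      (fun t => runError Tf G X 0 (((i₀ + k * h : ℕ) : ℝ) * T + t))
      (fun t ht => hrun.refTraj_mem hTf0 hG 0 _ (hshift _ hkj t ht))
      (fun t ht => ?_) (hsol.shift hm.1 hms)
      (by simpa using hsol.mem_unitaryGroup hsol0 _ hm)
      (by simpa using (hrun.pdist_runError_le hE hK hTf0 hG 0 hm).trans hd0)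
    · simpa using this
    · rw [norm_refTraj_sub_refTraj_shift hT hv hG hX0 (hrun.init 0) hΦ hΦ0 hkj hjs ht,
        show j - (i₀ + k * h) = h * (N - k) by
          rw [hi₀, Nat.mul_sub, Nat.mul_comm h N, Nat.mul_comm h k]; omega, pow_mul]
      refine (norm_pow_sub_one_le (pow_mem hP h) _).trans ?_
      have hNk : ((N - k : ℕ) : ℝ) ≤ N + 1 := by
        exact_mod_cast (Nat.sub_le N k).trans N.le_succ
      calc ((N - k : ℕ) : ℝ) * ‖Φ T ^ h - 1‖ ≤ (N + 1) * (δ / (N + 1)) := by gcongr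
        _ = δ := by field_simp
  refine hrun.contracts hE hK hG hjT (by linarith) hr0 hr1 hε0.le hd0 (fun ℓ hclose => ?_) hsmall
    (le_trans ?_ hε)
  · refine contracts_of_close hE hK hjT hs hjs (fun Yt hYt h0 hYc => ?_) hr0.le
    refine hwin _ Yt (fun t ht => hrun.refTraj_mem hTf0 hG ℓ _ (hshift j le_rfl t ht))
      (fun t ht => ?_) hYt h0 hYc
    rw [hlast t ht]
    exact hclose _ ⟨by linarith [ht.1], by linarith [ht.2]⟩
  · have h1r : 0 < 1 - r := by linarith
    have := Q.ctrlBound_nonneg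
    gcongr
    linarith

end RIGA

/-! ### The convergence theorem. -/

theorem mainTheorem2 {n nbar m : ℕ} (Q : RIGA.QuantumSystem n m) (hQ : Q.Controllable)
    (E : Matrix (Fin n) (Fin nbar) ℂ) (hE : Eᴴ * E = 1)
    (K : ℝ) (hK : 0 < K) (c : ℝ) (hc0 : 0 < c) (hc2 : c < 2) :
    -- the constant in (c), as a function of `θ`; it depends only on the system, `E`, `K` and `c`
    ∃ Lbar : ℝ → ℝ,
      ∀ (F : Matrix (Fin n) (Fin nbar) ℂ) (Xgoal : Matrix (Fin n) (Fin n) ℂ),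
        Xgoal ∈ Matrix.unitaryGroup (Fin n) ℂ → Xgoal * E = F →
      ∀ (T : ℝ), 0 < T → ∀ (M : ℕ), 0 < M → ∀ (a b : Fin m → Fin M → ℝ) (L₀ : ℝ), 0 < L₀ →
        (∀ t : ℝ, 0 ≤ t → ∀ k, |RIGA.seedInput T a b t k| ≤ L₀) →
      ∀ (lam : ℝ), 0 < lam → lam < 1 → ∀ (T₀ : ℝ), 0 ≤ T₀ →
        -- the reference trajectory of the seed is `lam`-attractive for every horizon `Tf > T₀`
        (∀ Tf > T₀, ∀ X₀ : ℝ → Matrix (Fin n) (Fin n) ℂ,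
          Q.IsTrajectory Tf (RIGA.seedInput T a b) X₀ → X₀ 0 = 1 →
          RIGA.IsAttractive Q E K Tf c lam (RIGA.refTraj Tf Xgoal X₀)) →
      ∃ Tstar : ℝ, ∀ Tf > Tstar,
        ∀ (u : ℕ → ℝ → Fin m → ℝ) (X : ℕ → ℝ → Matrix (Fin n) (Fin n) ℂ),
          RIGA.IsRun Q E K Tf (RIGA.seedInput T a b) (fun _ => Xgoal) u X →
          -- the initial value of the Lyapunov function, at the beginning of the first step
          RIGA.lyap E ((RIGA.refTraj Tf Xgoal (X 0) 0)ᴴ * X 1 0) ≤ c ^ 2 →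
        ∃ θ : ℝ, 0 < θ ∧ θ < 1 ∧
          -- (a)
          (∀ ℓ : ℕ, RIGA.IsAttractive Q E K Tf c θ (RIGA.refTraj Tf Xgoal (X ℓ))) ∧
          -- (b)
          (∀ ℓ : ℕ, RIGA.pdist E (X (ℓ + 1) Tf) Xgoal ≤
            Real.sqrt θ * RIGA.pdist E (X ℓ Tf) Xgoal) ∧
          (∀ ℓ : ℕ, RIGA.pdist E (X ℓ Tf) Xgoal ≤
            Real.sqrt θ ^ ℓ * RIGA.pdist E (X 0 Tf) Xgoal) ∧
          Antitone (fun ℓ : ℕ => RIGA.pdist E (X ℓ Tf) Xgoal) ∧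
          Tendsto (fun ℓ : ℕ => RIGA.pdist E (X ℓ Tf) Xgoal) atTop (𝓝 0) ∧
          -- (c)
          (∀ (ℓ : ℕ), ∀ t ∈ Icc 0 Tf, ∀ k : Fin m, |u ℓ t k| ≤ L₀ + Lbar θ) := by
  -- The sum of the geometric series of corrections with ratio `√θ`, started from the largest
  -- admissible distance `c`. Below, `θ = r ^ 2` with any `r` strictly between `√lam` and `1`.
  refine ⟨fun θ => 2 * K * ‖E‖ * Q.ctrlBound * (c / (1 - Real.sqrt θ)), ?_⟩
  intro F G hG _ T hT M _ a b L₀ _ hL₀ lam hlam0 hlam1 T₀ hT₀ hatt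
  have hsq : Real.sqrt lam < 1 := by rw [Real.sqrt_lt' one_pos]; simpa using hlam1
  obtain ⟨r, hlr, hr1⟩ := exists_between hsq
  have hr0 : 0 < r := (Real.sqrt_nonneg _).trans_lt hlr
  obtain ⟨Tstar, hTstar, hmain⟩ := RIGA.exists_horizon_contracts hE hK hc0 hG
    (RIGA.continuous_seedInput T a b) hT (RIGA.seedInput_add_period hT.ne' a b) hT₀ hlr hr1 hatt
  refine ⟨Tstar, fun Tf hTf u X hrun hV => ?_⟩
  have hTf0 : 0 ≤ Tf := by linarith
  have hd0 : RIGA.pdist E (X 0 Tf) G ≤ c := by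
    change RIGA.lyap E (RIGA.runError Tf G X 0 0) ≤ c ^ 2 at hV
    rw [RIGA.lyap_eq_pdist_sq hE (hrun.runError_zero_mem hTf0 hG 0),
      hrun.pdist_runError_zero hG] at hV
    exact (sq_le_sq₀ (RIGA.pdist_nonneg _ _ _) hc0.le).1 hV
  have hcon := hmain Tf hTf u X hrun hd0
  have hpow : ∀ ℓ, RIGA.pdist E (X ℓ Tf) G ≤ r ^ ℓ * RIGA.pdist E (X 0 Tf) G := fun ℓ =>
    hrun.pdist_le_pow hTf0 hG hr0.le hr1.le (fun i _ => hcon i) hd0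
  have hpc : ∀ ℓ, RIGA.pdist E (X ℓ Tf) G ≤ r ^ ℓ * c := fun ℓ =>
    (hpow ℓ).trans (by gcongr)
  have hstep : ∀ ℓ, RIGA.pdist E (X (ℓ + 1) Tf) G ≤ r * RIGA.pdist E (X ℓ Tf) G := fun ℓ =>
    hrun.pdist_succ_le hTf0 hG (hcon ℓ)
      ((hpc ℓ).trans (mul_le_of_le_one_left hc0.le (pow_le_one₀ hr0.le hr1.le)))
  have hsr : Real.sqrt (r ^ 2) = r := Real.sqrt_sq hr0.le
  refine ⟨r ^ 2, by positivity, by nlinarith, fun ℓ => (hcon ℓ).isAttractive hE hTf0 hr0 hr1, ?_⟩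
  simp only [hsr]
  refine ⟨hstep, hpow, antitone_nat_of_succ_le fun ℓ => (hstep ℓ).trans
    (mul_le_of_le_one_left (RIGA.pdist_nonneg _ _ _) hr1.le), ?_, fun ℓ t ht k => ?_⟩
  · refine squeeze_zero (fun ℓ => RIGA.pdist_nonneg _ _ _) hpc ?_
    simpa using (tendsto_pow_atTop_nhds_zero_of_lt_one hr0.le hr1).mul_const c
  · have h1 := hrun.abs_input_sub_le hK.le hTf0 hG ℓ ht k hc0.le hr0.le hr1 fun i _ =>
      (hrun.pdist_runError_le hE hK hTf0 hG i ht).trans ((hpc i).trans_eq (mul_comm _ _))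
    have h2 : |u 0 t k| ≤ L₀ := by
      rw [hrun.seed_eq t ht]
      exact hL₀ t ht.1 k
    calc |u ℓ t k| = |u 0 t k + (u ℓ t k - u 0 t k)| := by rw [add_sub_cancel]
      _ ≤ _ := (abs_add_le _ _).trans (add_le_add h2 h1)
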